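/- A permutation of length $n=|\pi|$ is a sequence $\pi=\pi_1\cdots\pi_n$ of distinct positive integers. Let $\mathrm{des}(\pi)$ be the number of $i\in\{1,\dots,n-1\}$ with $\pi_i>\pi_{i+1}$. A birun of $\pi$ is a maximal monotone consecutive subsequence of $\pi$, and $\mathrm{udr}(\pi)$ is the number of biruns of $\pi$, plus $1$ if $n\ge 2$ and $\pi_1>\pi_2$. For disjoint $\pi,\sigma$ (no common letters), $S(\pi,\sigma)$ is the set of permutations of length $|\pi|+|\sigma|$ that have both $\pi$ and $\sigma$ as subsequences. A statistic $\mathrm{st}$ (a function on permutations depending only on relative order) is shuffle-compatible if for all disjoint $\pi,\sigma$ the multiset $\{\mathrm{st}(\tau)\mid\tau\in S(\pi,\sigma)\}$ depends only on $\mathrm{st}(\pi)$, $\mathrm{st}(\sigma)$, $|\pi|$, $|\sigma|$. In that case its shuffle algebra $\mathcal A_{\mathrm{st}}$ is the $\mathbb Q$-algebra whose basis consists of the classes $[\pi]_{\mathrm{st}}$ of permutations under the equivalence "same length and same value of $\mathrm{st}$", with product $[\pi]_{\mathrm{st}}[\sigma]_{\mathrm{st}}=\sum_{\tau\in S(\pi,\sigma)}[\tau]_{\mathrm{st}}$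 for disjoint $\pi,\sigma$; its $n$th homogeneous component is the span of the $[\pi]_{\mathrm{st}}$ with $|\pi|=n$. Let $\mathbb Q[[t*]][x,y]$ be the algebra of polynomials in $x,y$ whose coefficients are formal power series in $t$, with the Hadamard product $\bigl(\sum a_nt^n\bigr)*\bigl(\sum b_nt^n\bigr)=\sum a_nb_nt^n$ in $t$ and the ordinary product in $x$ and $y$. In the displayed formulas below, all products, powers and quotients are ordinary ones. **Theorem.** (a) The pair $(\mathrm{udr},\mathrm{des})$ is shuffle-compatible. (b) The linear map on $\mathcal A_{(\mathrm{udr},\mathrm{des})}$ defined by $$[\pi]_{(\mathrm{udr},\mathrm{des})}\mapsto\begin{cases}\dfrac{N_\pi}{(1-t)(1-t^2)^{|\pi|}}\,x^{|\pi|},&|\pi|\ge1,\\[2mm] \dfrac1{1-t},&|\pi|=0,\end{cases}$$ where, with $u=\mathrm{udr}(\pi)$ and $d=\mathrm{des}(\pi)$, $$N_\pi=t^{u}(1+y)^{u-1}(1+yt^2)^{|\pi|-d-\lceil u/2\rceil}(y+t^2)^{d-\lfloor u/2\rfloor}(1+yt)^{\lceil u/2\rceil-\lfloor u/2\rfloor}(y+t)^{1-\lceil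 u/2\rceil+\lfloor u/2\rfloor},$$ is a $\mathbb Q$-algebra isomorphism from $\mathcal A_{(\mathrm{udr},\mathrm{des})}$ to the span of $$\left\{\frac1{1-t}\right\}\cup\left\{\frac{t(1+yt)(1+yt^2)^{n-1}}{(1-t)(1-t^2)^n}x^n\right\}_{n\ge1}\cup\left\{\frac{t^j(1+y)^{j-1}(1+yt^2)^{n-k-\lceil j/2\rceil}(y+t^2)^{k-\lfloor j/2\rfloor}S_j}{(1-t)(1-t^2)^n}x^n\right\}_{\substack{n\ge1,\ 2\le j\le n,\\ \lfloor j/2\rfloor\le k\le n-\lceil j/2\rceil}},$$ where $S_j$ is $1+yt$ if $j$ is odd and $y+t$ if $j$ is even; this span is a subalgebra of $\mathbb Q[[t*]][x,y]$. (c) For every $n\ge0$, the $n$th homogeneous component of $\mathcal A_{(\mathrm{udr},\mathrm{des})}$ has dimension $\binom n2+1$. -/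

import Mathlib

namespace ShuffleCompat

/-! ### Permutations, statistics, shuffles -/

/-- A permutation: a finite sequence of pairwise distinct positive integers. -/
abbrev Permutation : Type := {l : List ℕ+ // l.Nodup}

/-- The length of a permutation. -/
def Permutation.len (p : Permutation) : ℕ := p.1.length

/-- Two permutations are disjoint if they have no letter in common. -/
def DisjointPerm (p q : Permutation) : Prop := ∀ a ∈ p.1, a ∉ q.1

/-- Two sequences have the same relative order: same length, and the letters in any two
positions compare in the same way. -/
def SameOrder (p q : Permutation) : Prop :=
  p.1.length = q.1.length ∧
    ∀ (i j : ℕ) (hi : i < p.1.length) (hj : j < p.1.length)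
      (hi' : i < q.1.length) (hj' : j < q.1.length), p.1[i] < p.1[j] ↔ q.1[i] < q.1[j]

/-- A permutation statistic: a function on permutations that depends only on relative order. -/
structure Statistic (α : Type) where
  /-- the underlying function -/
  val : Permutation → α
  /-- invariance under the passage to a permutation of the same relative order -/
  inv : ∀ p q : Permutation, SameOrder p q → val p = val q

/-- The set of shuffles of two disjoint permutations; see `mem_shuffles`. -/
def shuffles (p q : Permutation) : Finset Permutation :=
  Finset.subtype (fun l : List ℕ+ => l.Nodup)
    ((p.1 ++ q.1).permutations.toFinset.filter
      (fun l => List.Sublist p.1 l ∧ List.Sublist q.1 l))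

theorem mem_shuffles_iff {p q r : Permutation} :
    r ∈ shuffles p q ↔
      r.1.Perm (p.1 ++ q.1) ∧ List.Sublist p.1 r.1 ∧ List.Sublist q.1 r.1 := by
  simp only [shuffles, Finset.mem_subtype, Finset.mem_filter, List.mem_toFinset,
    List.mem_permutations]

/-- The shuffles of disjoint `p`, `q` are exactly the permutations of length `|p| + |q|` of which
both `p` and `q` are subsequences. -/
theorem mem_shuffles {p q : Permutation} (h : DisjointPerm p q) (r : Permutation) :
    r ∈ shuffles p q ↔
      r.len = p.len + q.len ∧ List.Sublist p.1 r.1 ∧ List.Sublist q.1 r.1 := by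
  have hn : (p.1 ++ q.1).Nodup :=
    List.nodup_append.2 ⟨p.2, q.2, fun a ha b hb hab => h a ha (hab ▸ hb)⟩
  simp only [mem_shuffles_iff, Permutation.len]
  constructor
  · rintro ⟨h1, h2⟩
    exact ⟨by simpa using h1.length_eq, h2⟩
  · rintro ⟨h1, h2, h3⟩
    refine ⟨?_, h2, h3⟩
    have hs : (p.1 ++ q.1) ⊆ r.1 := by
      intro a ha
      rcases List.mem_append.1 ha with ha | ha
      · exact h2.subset ha
      · exact h3.subset ha
    exact ((List.subperm_of_subset hn hs).perm_of_length_le (by simp [h1])).symm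

/-- Shuffle-compatibility: for disjoint `p`, `q`, the multiset of values of the statistic on the
shuffles of `p` and `q` depends only on the values of the statistic on `p` and `q` and on the
lengths of `p` and `q`. -/
def ShuffleCompatible {α : Type} (st : Statistic α) : Prop :=
  ∀ p p' q q' : Permutation, DisjointPerm p q → DisjointPerm p' q' →
    p.len = p'.len → q.len = q'.len → st.val p = st.val p' → st.val q = st.val q' →
    (shuffles p q).val.map st.val = (shuffles p' q').val.map st.val

/-! ### The shuffle algebra of a shuffle-compatible statistic -/

/-- Equivalence of permutations under a statistic: same value and same length. -/
def statSetoid {α : Type} (st : Statistic α) : Setoid Permutation where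
  r p q := st.val p = st.val q ∧ p.len = q.len
  iseqv := ⟨fun _ => ⟨rfl, rfl⟩, fun h => ⟨h.1.symm, h.2.symm⟩,
    fun h h' => ⟨h.1.trans h'.1, h.2.trans h'.2⟩⟩

/-- The equivalence classes of permutations under a statistic. -/
def StatClass {α : Type} (st : Statistic α) : Type := Quotient (statSetoid st)

/-- The equivalence class of a permutation. -/
def mkClass {α : Type} (st : Statistic α) (p : Permutation) : StatClass st :=
  Quotient.mk (statSetoid st) p

theorem mkClass_eq {α : Type} {st : Statistic α} {p q : Permutation} :
    mkClass st p = mkClass st q ↔ st.val p = st.val q ∧ p.len = q.len :=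
  Quotient.eq (r := statSetoid st)

/-- Every class has a representative that avoids a given finite list of letters. -/
theorem exists_rep_avoiding {α : Type} (st : Statistic α) (a : StatClass st) (L : List ℕ+) :
    ∃ p : Permutation, mkClass st p = a ∧ ∀ x ∈ p.1, x ∉ L := by
  induction a using Quotient.inductionOn with
  | h p =>
    have hb : ∃ N : ℕ+, ∀ x ∈ L, x ≤ N := by
      induction L with
      | nil => exact ⟨1, by simp⟩
      | cons a L ih =>
        obtain ⟨N, hN⟩ := ih
        refine ⟨max a N, ?_⟩
        intro x hx
        rcases List.mem_cons.1 hx with rfl | hx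
        · exact le_max_left _ _
        · exact (hN x hx).trans (le_max_right _ _)
    obtain ⟨N, hN⟩ := hb
    refine ⟨⟨p.1.map (fun x => x + N), p.2.map (add_left_injective N)⟩, ?_, ?_⟩
    · refine mkClass_eq.2 ⟨st.inv _ _ ⟨by simp, ?_⟩, by simp [Permutation.len]⟩
      intro i j hi hj hi' hj'
      simp
    · intro x hx hxL
      obtain ⟨y, -, rfl⟩ := List.mem_map.1 hx
      have h1 := hN _ hxL
      have h2 : N < y + N := by
        rw [add_comm]; exact PNat.lt_add_right N y
      exact absurd h1 (not_le.2 h2)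

/-- The underlying vector space of the shuffle algebra of a shuffle-compatible statistic: the
rational vector space with basis the equivalence classes. -/
def ShuffleAlgebra {α : Type} (st : Statistic α) (_h : ShuffleCompatible st) : Type :=
  StatClass st →₀ ℚ

section Algebra

variable {α : Type} {st : Statistic α} {h : ShuffleCompatible st}

noncomputable instance : AddCommGroup (ShuffleAlgebra st h) :=
  inferInstanceAs (AddCommGroup (StatClass st →₀ ℚ))

noncomputable instance : Module ℚ (ShuffleAlgebra st h) :=
  inferInstanceAs (Module ℚ (StatClass st →₀ ℚ))

/-- The basis of the shuffle algebra given by the equivalence classes. -/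
noncomputable def classBasis (st : Statistic α) (h : ShuffleCompatible st) :
    Module.Basis (StatClass st) ℚ (ShuffleAlgebra st h) :=
  ⟨LinearEquiv.refl ℚ (StatClass st →₀ ℚ)⟩

/-- The basis element given by the equivalence class of a permutation. -/
noncomputable def cls (st : Statistic α) (h : ShuffleCompatible st) (p : Permutation) :
    ShuffleAlgebra st h :=
  classBasis st h (mkClass st p)

/-- The product of two classes: the sum of the classes of all shuffles of disjoint
representatives. The result does not depend on the representatives, see `cls_mul_cls`. -/
noncomputable def mulClass (st : Statistic α) (h : ShuffleCompatible st) (a b : StatClass st) :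
    ShuffleAlgebra st h :=
  let p := (exists_rep_avoiding st a []).choose
  let q := (exists_rep_avoiding st b p.1).choose
  ∑ r ∈ shuffles p q, cls st h r

/-- The bilinear extension of `mulClass`. -/
noncomputable def mulBilin (st : Statistic α) (h : ShuffleCompatible st) :
    ShuffleAlgebra st h →ₗ[ℚ] ShuffleAlgebra st h →ₗ[ℚ] ShuffleAlgebra st h :=
  (classBasis st h).constr ℚ fun a => (classBasis st h).constr ℚ fun b => mulClass st h a b

noncomputable instance : Mul (ShuffleAlgebra st h) := ⟨fun a b => mulBilin st h a b⟩

/-- The unit is the class of the empty permutation. -/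
noncomputable instance : One (ShuffleAlgebra st h) := ⟨cls st h ⟨[], List.nodup_nil⟩⟩

theorem mul_def (a b : ShuffleAlgebra st h) : a * b = mulBilin st h a b := rfl

/-- The defining multiplication rule, for arbitrary disjoint representatives. -/
theorem cls_mul_cls {p q : Permutation} (hpq : DisjointPerm p q) :
    cls st h p * cls st h q = ∑ r ∈ shuffles p q, cls st h r := by
  have h0 : cls st h p * cls st h q = mulClass st h (mkClass st p) (mkClass st q) := by
    simp [mul_def, mulBilin, cls, Module.Basis.constr_basis]
  rw [h0, mulClass]
  set p' := (exists_rep_avoiding st (mkClass st p) []).choose with hp'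
  have hp1 := (exists_rep_avoiding st (mkClass st p) []).choose_spec.1
  rw [← hp'] at hp1
  set q' := (exists_rep_avoiding st (mkClass st q) p'.1).choose with hq'
  have hq1 := (exists_rep_avoiding st (mkClass st q) p'.1).choose_spec
  rw [← hq'] at hq1
  have hd : DisjointPerm p' q' := fun a ha hb => hq1.2 a hb ha
  rw [mkClass_eq] at hp1
  have hq2 := mkClass_eq.1 hq1.1
  have key := h p' p q' q hd hpq hp1.2 hq2.2 hp1.1 hq2.1
  rw [← Multiset.rel_eq, Multiset.rel_map] at key
  have key2 : Multiset.Rel (fun a b => cls st h a = cls st h b)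
      (shuffles p' q').val (shuffles p q).val := by
    refine key.mono fun a ha b hb hab => ?_
    have ha' := (mem_shuffles hd a).1 ha
    have hb' := (mem_shuffles hpq b).1 hb
    simp only [cls]
    congr 1
    exact mkClass_eq.2 ⟨hab, by rw [ha'.1, hb'.1, hp1.2, hq2.2]⟩
  have key3 : (shuffles p' q').val.map (cls st h) = (shuffles p q).val.map (cls st h) := by
    rw [← Multiset.rel_eq, Multiset.rel_map]
    exact key2
  exact congrArg Multiset.sum key3

theorem shuffles_comm (p q : Permutation) : shuffles p q = shuffles q p := by
  ext r
  simp only [mem_shuffles_iff, and_comm (a := List.Sublist p.1 r.1)]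
  rw [List.perm_append_comm.congr_right]

/-- A subsequence of a sequence with distinct letters is its restriction to some letters. -/
theorem filter_eq_of_sublist {l m : List ℕ+} (hm : m.Nodup) (hl : List.Sublist l m) :
    m.filter (fun a => decide (a ∈ l)) = l := by
  have h1 : List.Sublist l (m.filter (fun a => decide (a ∈ l))) := by
    have h2 := hl.filter (fun a => decide (a ∈ l))
    rwa [List.filter_eq_self.2 (by simp)] at h2
  refine (h1.eq_of_length_le ?_).symm
  refine (List.subperm_of_subset (hm.filter _) ?_).length_le
  intro a ha
  simpa using (List.mem_filter.1 ha).2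

/-- Restricting a sequence to the letters of the first two of three disjoint blocks. -/
theorem perm_filter {p q s : Permutation} (hps : DisjointPerm p s) (hqs : DisjointPerm q s)
    {t : List ℕ+} (ht : t.Perm (p.1 ++ q.1 ++ s.1)) :
    (t.filter (fun a => decide (a ∈ p.1 ++ q.1))).Perm (p.1 ++ q.1) := by
  have h1 := ht.filter (fun a => decide (a ∈ p.1 ++ q.1))
  have h2 : (p.1 ++ q.1).filter (fun a => decide (a ∈ p.1 ++ q.1)) = p.1 ++ q.1 :=
    List.filter_eq_self.2 fun a ha => by simpa using ha
  have h3 : s.1.filter (fun a => decide (a ∈ p.1 ++ q.1)) = [] := by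
    refine List.filter_eq_nil_iff.2 fun a ha hc => ?_
    rcases List.mem_append.1 (of_decide_eq_true hc) with hc | hc
    · exact hps a hc ha
    · exact hqs a hc ha
  rwa [List.filter_append, h2, h3, List.append_nil] at h1

/-- Iterated shuffles of three pairwise disjoint permutations. -/
theorem mem_biUnion_shuffles {p q s : Permutation} (hps : DisjointPerm p s)
    (hqs : DisjointPerm q s) (t : Permutation) :
    t ∈ (shuffles p q).biUnion (fun r => shuffles r s) ↔
      t.1.Perm (p.1 ++ q.1 ++ s.1) ∧
        List.Sublist p.1 t.1 ∧ List.Sublist q.1 t.1 ∧ List.Sublist s.1 t.1 := by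
  simp only [Finset.mem_biUnion, mem_shuffles_iff]
  constructor
  · rintro ⟨r, ⟨h1, h2, h3⟩, h4, h5, h6⟩
    exact ⟨h4.trans (h1.append_right _), h2.trans h5, h3.trans h5, h6⟩
  · rintro ⟨h1, h2, h3, h4⟩
    have h5 := perm_filter hps hqs h1
    have h6 : ∀ l : List ℕ+, (∀ a ∈ l, a ∈ p.1 ++ q.1) → List.Sublist l t.1 →
        List.Sublist l (t.1.filter (fun a => decide (a ∈ p.1 ++ q.1))) := by
      intro l hl hlt
      have h7 := hlt.filter (fun a => decide (a ∈ p.1 ++ q.1))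
      rwa [List.filter_eq_self.2 fun a ha => decide_eq_true (hl a ha)] at h7
    exact ⟨⟨_, t.2.filter _⟩, ⟨h5, h6 _ (fun a ha => List.mem_append_left _ ha) h2,
      h6 _ (fun a ha => List.mem_append_right _ ha) h3⟩,
      h1.trans (h5.symm.append_right _), List.filter_sublist, h4⟩

theorem disjoint_of_mem_shuffles {p q r s : Permutation} (hps : DisjointPerm p s)
    (hqs : DisjointPerm q s) (hr : r ∈ shuffles p q) : DisjointPerm r s := by
  intro a ha
  rcases List.mem_append.1 ((mem_shuffles_iff.1 hr).1.mem_iff.1 ha) with ha | ha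
  · exact hps a ha
  · exact hqs a ha

theorem cls_mul_cls_mul_cls {p q s : Permutation} (hpq : DisjointPerm p q)
    (hps : DisjointPerm p s) (hqs : DisjointPerm q s) :
    cls st h p * cls st h q * cls st h s =
      ∑ t ∈ (shuffles p q).biUnion (fun r => shuffles r s), cls st h t := by
  rw [cls_mul_cls hpq, mul_def, map_sum, LinearMap.sum_apply, Finset.sum_biUnion]
  · refine Finset.sum_congr rfl fun r hr => ?_
    rw [← mul_def, cls_mul_cls (disjoint_of_mem_shuffles hps hqs hr)]
  · intro r hr r' hr' hne
    refine Finset.disjoint_left.2 fun t ht ht' => hne (Subtype.ext ?_)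
    have h1 := mem_shuffles_iff.1 hr
    have h2 := mem_shuffles_iff.1 hr'
    rw [← filter_eq_of_sublist t.2 (mem_shuffles_iff.1 ht).2.1,
      ← filter_eq_of_sublist t.2 (mem_shuffles_iff.1 ht').2.1]
    refine List.filter_congr fun a _ => ?_
    simp only [h1.1.mem_iff, h2.1.mem_iff]

theorem mul_comm_aux (a b : ShuffleAlgebra st h) : a * b = b * a := by
  have key : mulBilin st h = (mulBilin st h).flip := by
    refine (classBasis st h).ext fun a => (classBasis st h).ext fun b => ?_
    obtain ⟨p, rfl, -⟩ := exists_rep_avoiding st a []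
    obtain ⟨q, rfl, hq⟩ := exists_rep_avoiding st b p.1
    have h1 : DisjointPerm p q := fun x hx hx' => hq x hx' hx
    change cls st h p * cls st h q = cls st h q * cls st h p
    rw [cls_mul_cls h1, cls_mul_cls hq, shuffles_comm]
  exact LinearMap.congr_fun₂ key a b

theorem cls_assoc {p q s : Permutation} (hpq : DisjointPerm p q)
    (hps : DisjointPerm p s) (hqs : DisjointPerm q s) :
    cls st h p * cls st h q * cls st h s = cls st h p * (cls st h q * cls st h s) := by
  have hqp : DisjointPerm q p := fun a ha hb => hpq a hb ha
  have hsp : DisjointPerm s p := fun a ha hb => hps a hb ha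
  rw [cls_mul_cls_mul_cls hpq hps hqs, mul_comm_aux (cls st h p),
    cls_mul_cls_mul_cls hqs hqp hsp]
  congr 1
  ext t
  rw [mem_biUnion_shuffles hps hqs, mem_biUnion_shuffles hqp hsp]
  have h1 : (p.1 ++ q.1 ++ s.1).Perm (q.1 ++ s.1 ++ p.1) := by
    rw [List.append_assoc]
    exact List.perm_append_comm
  rw [h1.congr_right]
  tauto

theorem mul_assoc_aux (a b c : ShuffleAlgebra st h) : a * b * c = a * (b * c) := by
  have key1 : ∀ (i j : StatClass st) (c : ShuffleAlgebra st h),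
      classBasis st h i * classBasis st h j * c =
        classBasis st h i * (classBasis st h j * c) := by
    intro i j c
    have key : mulBilin st h (classBasis st h i * classBasis st h j) =
        (mulBilin st h (classBasis st h i)).comp (mulBilin st h (classBasis st h j)) := by
      refine (classBasis st h).ext fun k => ?_
      obtain ⟨p, rfl, -⟩ := exists_rep_avoiding st i []
      obtain ⟨q, rfl, hq⟩ := exists_rep_avoiding st j p.1
      obtain ⟨s, rfl, hs⟩ := exists_rep_avoiding st k (p.1 ++ q.1)
      exact cls_assoc (fun x hx hx' => hq x hx' hx)
        (fun x hx hx' => hs x hx' (List.mem_append_left _ hx))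
        (fun x hx hx' => hs x hx' (List.mem_append_right _ hx))
    exact LinearMap.congr_fun key c
  have key2 : ∀ (i : StatClass st) (b c : ShuffleAlgebra st h),
      classBasis st h i * b * c = classBasis st h i * (b * c) := by
    intro i b c
    have key : ((mulBilin st h).flip c).comp (mulBilin st h (classBasis st h i)) =
        (mulBilin st h (classBasis st h i)).comp ((mulBilin st h).flip c) :=
      (classBasis st h).ext fun j => key1 i j c
    exact LinearMap.congr_fun key b
  have key3 : ((mulBilin st h).flip c).comp ((mulBilin st h).flip b) =
      (mulBilin st h).flip (b * c) := (classBasis st h).ext fun i => key2 i b c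
  exact LinearMap.congr_fun key3 a

theorem one_mul_aux (a : ShuffleAlgebra st h) : 1 * a = a := by
  have key : mulBilin st h 1 = LinearMap.id := by
    refine (classBasis st h).ext fun a => ?_
    obtain ⟨p, rfl, -⟩ := exists_rep_avoiding st a []
    have h1 : DisjointPerm ⟨[], List.nodup_nil⟩ p := fun x hx => by simp at hx
    change cls st h ⟨[], List.nodup_nil⟩ * cls st h p = cls st h p
    rw [cls_mul_cls h1]
    have h2 : shuffles ⟨[], List.nodup_nil⟩ p = {p} := by
      ext r
      simp only [mem_shuffles_iff, Finset.mem_singleton, List.nil_append, List.nil_sublist,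
        true_and]
      constructor
      · rintro ⟨h3, h4⟩
        exact Subtype.ext (h4.eq_of_length h3.length_eq.symm).symm
      · rintro rfl
        exact ⟨List.Perm.refl _, List.Sublist.refl _⟩
    rw [h2, Finset.sum_singleton]
  exact LinearMap.congr_fun key a

noncomputable instance : CommRing (ShuffleAlgebra st h) :=
  { (inferInstance : AddCommGroup (ShuffleAlgebra st h)) with
    mul := fun a b => a * b
    one := 1
    left_distrib := fun a b c => by simp only [mul_def, map_add]
    right_distrib := fun a b c => by simp only [mul_def, map_add, LinearMap.add_apply]
    zero_mul := fun a => by simp only [mul_def, map_zero, LinearMap.zero_apply]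
    mul_zero := fun a => by simp only [mul_def, map_zero]
    mul_assoc := mul_assoc_aux
    mul_comm := mul_comm_aux
    one_mul := one_mul_aux
    mul_one := fun a => by rw [mul_comm_aux, one_mul_aux] }

noncomputable instance : Algebra ℚ (ShuffleAlgebra st h) :=
  Algebra.ofModule (fun r a b => by simp only [mul_def, map_smul, LinearMap.smul_apply])
    (fun r a b => by simp only [mul_def, map_smul])

/-- The `n`th homogeneous component of the shuffle algebra: the span of the classes of the
permutations of length `n`. -/
noncomputable def homogeneousComponent {α : Type} (st : Statistic α) (h : ShuffleCompatible st) (n : ℕ) :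
    Submodule ℚ (ShuffleAlgebra st h) :=
  Submodule.span ℚ {a | ∃ p : Permutation, p.len = n ∧ a = cls st h p}

end Algebra

/-! ### Descents and up-down runs -/

/-- The number of descents. Positions are counted from `0`. -/
def des (p : Permutation) : ℕ :=
  ((Finset.range p.1.length).filter
    (fun i => ∃ h : i + 1 < p.1.length, p.1[i + 1] < p.1[i])).card

/-- The consecutive subsequence occupying the positions `i, ..., j` is increasing. -/
def IncOn (p : Permutation) (i j : ℕ) : Prop :=
  ∀ (a b : ℕ) (ha : a < p.1.length) (hb : b < p.1.length),
    i ≤ a → a < b → b ≤ j → p.1[a] < p.1[b]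

/-- The consecutive subsequence occupying the positions `i, ..., j` is decreasing. -/
def DecOn (p : Permutation) (i j : ℕ) : Prop :=
  ∀ (a b : ℕ) (ha : a < p.1.length) (hb : b < p.1.length),
    i ≤ a → a < b → b ≤ j → p.1[b] < p.1[a]

/-- The positions `i, ..., j` carry a nonempty monotone consecutive subsequence. -/
def MonoSegment (p : Permutation) (i j : ℕ) : Prop :=
  i ≤ j ∧ j < p.1.length ∧ (IncOn p i j ∨ DecOn p i j)

/-- The positions `i, ..., j` carry a birun: a maximal monotone consecutive subsequence. -/
def IsBirun (p : Permutation) (i j : ℕ) : Prop :=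
  MonoSegment p i j ∧
    ∀ i' j' : ℕ, i' ≤ i → j ≤ j' → MonoSegment p i' j' → i' = i ∧ j' = j

/-- The number of biruns. -/
noncomputable def br (p : Permutation) : ℕ := {s : ℕ × ℕ | IsBirun p s.1 s.2}.ncard

/-- The first letter exceeds the second one. -/
def InitialDescent (p : Permutation) : Prop := ∃ h : 1 < p.1.length, p.1[1] < p.1[0]

open Classical in
/-- The number of up-down runs: the biruns, together with the first letter alone if it exceeds
the second letter (in that case the first letter alone is not a birun). -/
noncomputable def udr (p : Permutation) : ℕ := br p + if InitialDescent p then 1 else 0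

theorem SameOrder.symm {p q : Permutation} (h : SameOrder p q) : SameOrder q p :=
  ⟨h.1.symm, fun i j hi hj hi' hj' => (h.2 i j hi' hj' hi hj).symm⟩

theorem des_inv {p q : Permutation} (h : SameOrder p q) : des p = des q := by
  have key : ∀ {p q : Permutation}, SameOrder p q → ∀ i : ℕ,
      (∃ h : i + 1 < p.1.length, p.1[i + 1] < p.1[i]) →
        ∃ h : i + 1 < q.1.length, q.1[i + 1] < q.1[i] := by
    rintro p q h i ⟨h1, h2⟩
    have hl := h.1
    exact ⟨hl ▸ h1, (h.2 _ _ h1 (by omega) (hl ▸ h1) (by omega)).1 h2⟩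
  unfold des
  congr 1
  ext i
  rw [Finset.mem_filter, Finset.mem_filter, Finset.mem_range, Finset.mem_range]
  exact and_congr (by rw [h.1]) ⟨key h i, key h.symm i⟩

theorem MonoSegment.congr {p q : Permutation} (h : SameOrder p q) {i j : ℕ}
    (hp : MonoSegment p i j) : MonoSegment q i j := by
  have hl := h.1
  refine ⟨hp.1, hl ▸ hp.2.1, hp.2.2.imp (fun H => ?_) (fun H => ?_)⟩
  · intro a b ha hb h1 h2 h3
    exact (h.2 _ _ (by omega) (by omega) ha hb).1 (H a b (by omega) (by omega) h1 h2 h3)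
  · intro a b ha hb h1 h2 h3
    exact (h.2 _ _ (by omega) (by omega) hb ha).1 (H a b (by omega) (by omega) h1 h2 h3)

theorem udr_inv {p q : Permutation} (h : SameOrder p q) : udr p = udr q := by
  have h1 : ∀ i j, MonoSegment p i j ↔ MonoSegment q i j := fun i j =>
    ⟨MonoSegment.congr h, MonoSegment.congr h.symm⟩
  have h2 : br p = br q := by
    unfold br IsBirun
    simp only [h1]
  have h3 : InitialDescent p ↔ InitialDescent q := by
    constructor
    · rintro ⟨h4, h5⟩
      exact ⟨h.1 ▸ h4, (h.2 _ _ h4 (by omega) (h.1 ▸ h4) (by have := h.1; omega)).1 h5⟩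
    · rintro ⟨h4, h5⟩
      exact ⟨h.1 ▸ h4, (h.symm.2 _ _ h4 (by omega) (h.1 ▸ h4) (by have := h.1; omega)).1 h5⟩
  unfold udr
  rw [h2]
  by_cases h4 : InitialDescent p
  · rw [if_pos h4, if_pos (h3.1 h4)]
  · rw [if_neg h4, if_neg fun h5 => h4 (h3.2 h5)]

/-- The joint statistic `(udr, des)`. -/
noncomputable def udrDes : Statistic (ℕ × ℕ) where
  val p := (udr p, des p)
  inv _ _ h := by rw [udr_inv h, des_inv h]

/-! ### The Hadamard algebra and the explicit rational functions -/

/-- Formal power series in `t` over `ℚ` under the Hadamard product: the series `∑ aₙ tⁿ` is given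
by its coefficient sequence, and the product of sequences is taken termwise. -/
abbrev HadamardSeries : Type := ℕ → ℚ

/-- The algebra of polynomials in `x`, `y` (the variables `0` and `1`) whose coefficients are
power series in `t`, with the Hadamard product in `t` and ordinary products in `x` and `y`. -/
abbrev HadamardPoly : Type := MvPolynomial (Fin 2) HadamardSeries

/-- Polynomials in `x`, `y` whose coefficients are power series in `t`, with ordinary products;
here the explicit expressions below are formed. -/
abbrev OrdinaryPoly : Type := MvPolynomial (Fin 2) (PowerSeries ℚ)

/-- The identity map on formal expressions `∑ aₙᵢⱼ tⁿ xⁱ yʲ`, from the algebra with the ordinary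
product in `t` to the algebra with the Hadamard product in `t`. -/
noncomputable def toHadamard (f : OrdinaryPoly) : HadamardPoly :=
  ∑ m ∈ f.support, MvPolynomial.monomial m (fun n => PowerSeries.coeff n (MvPolynomial.coeff m f))

/-- The variable `t`. -/
noncomputable def t : OrdinaryPoly := MvPolynomial.C PowerSeries.X

/-- The variable `x`. -/
noncomputable def x : OrdinaryPoly := MvPolynomial.X 0

/-- The variable `y`. -/
noncomputable def y : OrdinaryPoly := MvPolynomial.X 1

/-- The series `1 / (1 - t)`. -/
noncomputable def invOneSub : OrdinaryPoly :=
  MvPolynomial.C (1 - PowerSeries.X : PowerSeries ℚ)⁻¹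

/-- The series `1 / ((1 - t) (1 - t ^ 2) ^ n)`. -/
noncomputable def invDenom (n : ℕ) : OrdinaryPoly :=
  MvPolynomial.C ((1 - PowerSeries.X) * (1 - PowerSeries.X ^ 2) ^ n : PowerSeries ℚ)⁻¹

/-- The numerator attached to a nonempty permutation; `(j + 1) / 2` and `j / 2` are the upper
and lower integer parts of half of `j`. All subtractions are exact for nonempty permutations. -/
noncomputable def numer (p : Permutation) : OrdinaryPoly :=
  t ^ udr p * (1 + y) ^ (udr p - 1)
    * (1 + y * t ^ 2) ^ (p.len - des p - (udr p + 1) / 2)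
    * (y + t ^ 2) ^ (des p - udr p / 2)
    * (1 + y * t) ^ ((udr p + 1) / 2 - udr p / 2)
    * (y + t) ^ (1 + udr p / 2 - (udr p + 1) / 2)

/-- The image of the class of a permutation. -/
noncomputable def image (p : Permutation) : HadamardPoly :=
  if p.len = 0 then toHadamard invOneSub
  else toHadamard (numer p * invDenom p.len * x ^ p.len)

/-- The factor `S_j`. -/
noncomputable def S (j : ℕ) : OrdinaryPoly := if Odd j then 1 + y * t else y + t

/-- The explicit spanning set. -/
def spanningSet : Set HadamardPoly :=
  {toHadamard invOneSub}
  ∪ {f | ∃ n : ℕ, 1 ≤ n ∧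
      f = toHadamard (t * (1 + y * t) * (1 + y * t ^ 2) ^ (n - 1) * invDenom n * x ^ n)}
  ∪ {f | ∃ n j k : ℕ, 1 ≤ n ∧ 2 ≤ j ∧ j ≤ n ∧ j / 2 ≤ k ∧ k ≤ n - (j + 1) / 2 ∧
      f = toHadamard (t ^ j * (1 + y) ^ (j - 1) * (1 + y * t ^ 2) ^ (n - k - (j + 1) / 2)
        * (y + t ^ 2) ^ (k - j / 2) * S j * invDenom n * x ^ n)}

end ShuffleCompat

namespace ShuffleCompat

/-! Fix `k` and label the letters of a permutation by `1, ..., k` so that labels weakly increase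
along the sequence, an odd label being repeated only across ascents and an even one only across
descents. Odd labels have weight `1`, even labels weight `y`; the total weight of these labelings is
`labelSum`. A labeling of all letters of two disjoint permutations sorts them in exactly one order
(`existsUnique_shuffle_compatible`), so for every `k` the product of two such sums is the sum over
all shuffles (`labelSum_mul_labelSum`). Read as power series in `t` with `k` as exponent, these
identities are one identity for the Hadamard product.

The series is computed by a recursion on the last label, split by parity (`series_lastLabelSum`). Up
to a factor `1 / (1 - t ^ 2)`, a further letter contributes `1 + y t ^ 2` or `y + t ^ 2` if it
continues the current run, up or down, and `t (1 + y)` if it opens a new one. Hence the series is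
the stated rational function and depends only on `udr`, `des` and the length
(`series_labelSum_perm`).

Images of distinct classes are linearly independent (`linearIndependent_classImage`): the lowest
power of `t` gives `udr`, the power of `x` the length, and the lowest power of `y` in that
coefficient then gives `des`. Since the sum of the images of all shuffles is determined by the
classes of the two factors, independence forces the multiset of classes of the shuffles to be
determined too. This is shuffle-compatibility, and the same facts make the map an injective algebra
homomorphism. The span and the dimensions follow from the list of values that `(udr, des)` takes
(`admissible_udr_des`, `exists_perm_of_admissible`). -/

/-! ### Descent patterns -/

/-- The number of up-down runs of a sequence of `m + 1` letters with descent pattern `D`. -/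
def numRuns (D : ℕ → Bool) : ℕ → ℕ
  | 0 => 1
  | m + 1 => if D m = decide (numRuns D m % 2 = 1) then numRuns D m + 1 else numRuns D m

/-- The number of descents of a sequence of `m + 1` letters with descent pattern `D`. -/
def numDes (D : ℕ → Bool) : ℕ → ℕ
  | 0 => 0
  | m + 1 => if D m then numDes D m + 1 else numDes D m

/-- Up-down runs alternate, starting with an up run that may consist of the first letter alone. So
an odd count means that the current run goes up. -/
theorem numRuns_parity (D : ℕ → Bool) (m : ℕ) :
    decide (numRuns D (m + 1) % 2 = 1) = !D m := by
  rw [numRuns]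
  by_cases h : numRuns D m % 2 = 1 <;> cases hD : D m <;> simp [h] <;> omega

theorem numRuns_pos (D : ℕ → Bool) (m : ℕ) : 1 ≤ numRuns D m := by
  induction m with
  | zero => simp [numRuns]
  | succ m ih => rw [numRuns]; split_ifs <;> omega

/-- Each of the `u / 2` down runs contains a descent, and each of the `(u + 1) / 2` up runs except
possibly the first contains an ascent. These bounds make all natural subtractions in the exponents
exact. -/
theorem numRuns_numDes_bounds (D : ℕ → Bool) (m : ℕ) :
    numRuns D m / 2 ≤ numDes D m ∧ numDes D m + (numRuns D m + 1) / 2 ≤ m + 1 := by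
  induction m with
  | zero => simp [numRuns, numDes]
  | succ m ih =>
    rw [numRuns, numDes]
    by_cases h : numRuns D m % 2 = 1 <;> cases hD : D m <;> simp [h] <;> omega

theorem numDes_eq_zero_of_numRuns_eq_one (D : ℕ → Bool) (m : ℕ) (h : numRuns D m = 1) :
    numDes D m = 0 := by
  induction m with
  | zero => simp [numDes]
  | succ m ih =>
    have h1 := numRuns_pos D m
    rw [numRuns] at h
    rw [numDes]
    by_cases h2 : numRuns D m = 1
    · cases hD : D m <;> simp_all
    · split_ifs at h <;> omega

theorem numRuns_congr {D D' : ℕ → Bool} {m : ℕ} (h : ∀ i < m, D i = D' i) :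
    numRuns D m = numRuns D' m := by
  induction m with
  | zero => rfl
  | succ m ih => rw [numRuns, numRuns, ih fun i hi => h i (by omega), h m (by omega)]

theorem numDes_congr {D D' : ℕ → Bool} {m : ℕ} (h : ∀ i < m, D i = D' i) :
    numDes D m = numDes D' m := by
  induction m with
  | zero => rfl
  | succ m ih => rw [numDes, numDes, ih fun i hi => h i (by omega), h m (by omega)]

/-- The possible values of `(udr, des)` on the permutations of length `n`. -/
def Admissible (n u d : ℕ) : Prop :=
  (n = 0 ∧ u = 0 ∧ d = 0) ∨ (1 ≤ n ∧ u = 1 ∧ d = 0) ∨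
    (2 ≤ u ∧ u ≤ n ∧ u / 2 ≤ d ∧ d ≤ n - (u + 1) / 2)

theorem admissible_numRuns_numDes (D : ℕ → Bool) (m : ℕ) :
    Admissible (m + 1) (numRuns D m) (numDes D m) := by
  have h1 := numRuns_numDes_bounds D m
  have h2 := numRuns_pos D m
  by_cases h3 : numRuns D m = 1
  · exact Or.inr (Or.inl ⟨by omega, h3, numDes_eq_zero_of_numRuns_eq_one D m h3⟩)
  · exact Or.inr (Or.inr ⟨by omega, by omega, by omega, by omega⟩)

theorem exists_pattern_snoc (D : ℕ → Bool) (m : ℕ) (b : Bool) :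
    ∃ D' : ℕ → Bool, D' m = b ∧ numRuns D' m = numRuns D m ∧ numDes D' m = numDes D m := by
  refine ⟨Function.update D m b, by simp, numRuns_congr ?_, numDes_congr ?_⟩ <;>
  · intro i hi
    rw [Function.update_of_ne (by omega)]

/-- Induction by removing the last step, which is an ascent if `u` is odd and a descent if `u` is
even. For `u ≥ 3` that step can be taken to open the last run. -/
theorem exists_pattern {m u d : ℕ} (h : Admissible (m + 1) u d) :
    ∃ D : ℕ → Bool, numRuns D m = u ∧ numDes D m = d := by
  induction m generalizing u d with
  | zero =>
    refine ⟨fun _ => false, ?_⟩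
    simp only [Admissible] at h
    simp only [numRuns, numDes]
    omega
  | succ m ih =>
    have key : ∀ (b : Bool) (u' d' : ℕ), Admissible (m + 1) u' d' →
        (if b = decide (u' % 2 = 1) then u' + 1 else u') = u →
        (if b then d' + 1 else d') = d →
        ∃ D : ℕ → Bool, numRuns D (m + 1) = u ∧ numDes D (m + 1) = d := by
      intro b u' d' h1 h2 h3
      obtain ⟨D, hu, hd⟩ := ih h1
      obtain ⟨D', hb, hu', hd'⟩ := exists_pattern_snoc D m b
      exact ⟨D', by rw [numRuns, hb, hu', hu, h2], by rw [numDes, hb, hd', hd, h3]⟩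
    rcases h with h | ⟨-, rfl, rfl⟩ | h
    · omega
    · exact key false 1 0 (Or.inr (Or.inl ⟨by omega, rfl, rfl⟩)) (by simp) (by simp)
    · by_cases hu : u % 2 = 1
      · refine key false (u - 1) d (Or.inr (Or.inr ?_)) ?_ (by simp)
        · omega
        · have : (u - 1) % 2 = 0 := by omega
          simp [this]; omega
      -- A single up run has no descents, so for `u = 2` the last step opens the down run only if `d
      -- = 1`; otherwise it prolongs it.
      · by_cases h2 : u = 2
        · by_cases h3 : d = 1
          · exact key true 1 0 (Or.inr (Or.inl ⟨by omega, rfl, rfl⟩)) (by simp [h2]) (by simp [h3])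
          · refine key true u (d - 1) (Or.inr (Or.inr ?_)) ?_ ?_
            · omega
            · simp [hu]
            · simp; omega
        · refine key true (u - 1) (d - 1) (Or.inr (Or.inr ?_)) ?_ ?_
          · omega
          · have : (u - 1) % 2 = 1 := by omega
            simp [this]; omega
          · simp; omega

/-! ### The generating function of compatible labelings -/

section Transfer

variable {R : Type*} [CommRing R] (y : R)

/-- The weight of a label: `1` if it is odd, `y` if it is even. -/
def labelWeight (v : ℕ) : R := if v % 2 = 1 then 1 else y

/-- The total weight of the compatible labelings of `m + 1` letters with descent pattern `D` whose
last label is `v`. -/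
def lastLabelSum (D : ℕ → Bool) : ℕ → ℕ → R
  | 0, v => if v = 0 then 0 else labelWeight y v
  | m + 1, v => labelWeight y v *
      ∑ w ∈ Finset.range (if D m = decide (v % 2 = 1) then v else v + 1), lastLabelSum D m w

theorem lastLabelSum_zero (D : ℕ → Bool) (m : ℕ) : lastLabelSum y D m 0 = 0 := by
  induction m with
  | zero => simp [lastLabelSum]
  | succ m ih =>
    rw [lastLabelSum]
    split_ifs <;> simp [ih]

/-- The part of odd degree of a generating function. -/
def oddSeries (e : ℕ → R) : PowerSeries R := PowerSeries.mk fun v => if v % 2 = 1 then e v else 0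

/-- The part of even degree of a generating function. -/
def evenSeries (e : ℕ → R) : PowerSeries R := PowerSeries.mk fun v => if v % 2 = 1 then 0 else e v

/-- Partial sums of a sequence. -/
def partialSum (e : ℕ → R) (v : ℕ) : R := ∑ w ∈ Finset.range (v + 1), e w

theorem partialSum_succ (e : ℕ → R) (v : ℕ) :
    partialSum e (v + 1) = partialSum e v + e (v + 1) := Finset.sum_range_succ _ _

open PowerSeries in
theorem coeff_succ_X_sq_mul (v : ℕ) (f : PowerSeries R) :
    coeff (v + 1 + 1) (X ^ 2 * f) = coeff v f := by
  rw [pow_two, mul_assoc, coeff_succ_X_mul, coeff_succ_X_mul]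

open PowerSeries in
-- Partial sums two apart differ by `e v + e (v - 1)`, and these two indices have opposite parity.
theorem one_sub_sq_mul_oddSeries (e : ℕ → R) :
    (1 - X ^ 2) * oddSeries (partialSum e) = oddSeries e + X * evenSeries e := by
  ext v
  rw [sub_mul, one_mul, map_sub, map_add]
  rcases v with _ | _ | v
  · simp [oddSeries, coeff_X_pow_mul', coeff_zero_X_mul]
  · simp [oddSeries, evenSeries, coeff_X_pow_mul', coeff_succ_X_mul, partialSum,
      Finset.sum_range_succ, add_comm]
  · rw [coeff_succ_X_sq_mul, coeff_succ_X_mul]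
    simp only [oddSeries, evenSeries, coeff_mk, partialSum_succ]
    rcases Nat.mod_two_eq_zero_or_one v with h | h
    · have h1 : (v + 1) % 2 = 1 := by omega
      have h2 : (v + 1 + 1) % 2 = 0 := by omega
      simp [h, h1, h2]
    · have h1 : (v + 1) % 2 = 0 := by omega
      have h2 : (v + 1 + 1) % 2 = 1 := by omega
      simp [h, h1, h2]; ring

open PowerSeries in
theorem one_sub_sq_mul_evenSeries (e : ℕ → R) :
    (1 - X ^ 2) * evenSeries (partialSum e) = evenSeries e + X * oddSeries e := by
  ext v
  rw [sub_mul, one_mul, map_sub, map_add]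
  rcases v with _ | _ | v
  · simp [evenSeries, coeff_X_pow_mul', coeff_zero_X_mul, partialSum]
  · simp [oddSeries, evenSeries, coeff_X_pow_mul', coeff_succ_X_mul]
  · rw [coeff_succ_X_sq_mul, coeff_succ_X_mul]
    simp only [oddSeries, evenSeries, coeff_mk, partialSum_succ]
    rcases Nat.mod_two_eq_zero_or_one v with h | h
    · have h1 : (v + 1) % 2 = 1 := by omega
      have h2 : (v + 1 + 1) % 2 = 0 := by omega
      simp [h, h1, h2]; ring
    · have h1 : (v + 1) % 2 = 0 := by omega
      have h2 : (v + 1 + 1) % 2 = 1 := by omega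
      simp [h, h1, h2]

open PowerSeries in
theorem one_sub_mul_partialSum (e : ℕ → R) :
    (1 - X) * mk (partialSum e) = oddSeries e + evenSeries e := by
  ext v
  rw [sub_mul, one_mul, map_sub, map_add]
  rcases v with _ | v
  · simp [oddSeries, evenSeries, coeff_zero_X_mul, partialSum]
  · rw [coeff_succ_X_mul]
    simp only [oddSeries, evenSeries, coeff_mk, partialSum_succ]
    split_ifs <;> simp

open PowerSeries in
-- Across an ascent an odd label `v` may follow any label up to `v`, an even one only labels up to
-- `v - 1`. Both cases thus use partial sums at odd indices only; across a descent the parities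
-- swap.
theorem series_of_ascent (D : ℕ → Bool) (m : ℕ) (h : D m = false) :
    oddSeries (lastLabelSum y D (m + 1)) = oddSeries (partialSum (lastLabelSum y D m)) ∧
      evenSeries (lastLabelSum y D (m + 1)) =
        C y * X * oddSeries (partialSum (lastLabelSum y D m)) := by
  constructor <;> ext v
  · simp only [oddSeries, coeff_mk]
    split_ifs with hv
    · simp [lastLabelSum, h, hv, labelWeight, partialSum]
    · rfl
  · rw [mul_assoc, coeff_C_mul]
    rcases v with _ | v
    · simp [evenSeries, lastLabelSum_zero, coeff_zero_X_mul]
    · rw [coeff_succ_X_mul]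
      simp only [oddSeries, evenSeries, coeff_mk]
      rcases Nat.mod_two_eq_zero_or_one v with hv | hv
      · have h1 : (v + 1) % 2 = 1 := by omega
        simp [hv, h1]
      · have h1 : (v + 1) % 2 = 0 := by omega
        simp [hv, h1, lastLabelSum, h, labelWeight, partialSum]

open PowerSeries in
theorem series_of_descent (D : ℕ → Bool) (m : ℕ) (h : D m = true) :
    oddSeries (lastLabelSum y D (m + 1)) = X * evenSeries (partialSum (lastLabelSum y D m)) ∧
      evenSeries (lastLabelSum y D (m + 1)) =
        C y * evenSeries (partialSum (lastLabelSum y D m)) := by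
  constructor <;> ext v
  · rcases v with _ | v
    · simp [oddSeries, coeff_zero_X_mul]
    · rw [coeff_succ_X_mul]
      simp only [oddSeries, evenSeries, coeff_mk]
      rcases Nat.mod_two_eq_zero_or_one v with hv | hv
      · have h1 : (v + 1) % 2 = 1 := by omega
        simp [hv, h1, lastLabelSum, h, labelWeight, partialSum]
      · have h1 : (v + 1) % 2 = 0 := by omega
        simp [hv, h1]
  · rw [coeff_C_mul]
    simp only [evenSeries, coeff_mk]
    split_ifs with hv
    · simp
    · have hv : v % 2 = 0 := by omega
      simp [lastLabelSum, h, hv, labelWeight, partialSum]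

open PowerSeries in
/-- The numerator without its last factor. -/
noncomputable def leadFactor (n u d : ℕ) : PowerSeries R :=
  X ^ u * (1 + C y) ^ (u - 1) * (1 + C y * X ^ 2) ^ (n - d - (u + 1) / 2)
    * (C y + X ^ 2) ^ (d - u / 2)

open PowerSeries in
-- The odd and even parts stay in the ratio `1 : y t` inside an up run and `t : y` inside a down
-- run. So odd plus `t` times even gives `1 + y t ^ 2` or `t (1 + y)` at an ascent, and even plus
-- `t` times odd gives `t (1 + y)` or `y + t ^ 2` at a descent.
theorem series_lastLabelSum (D : ℕ → Bool) (m : ℕ) :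
    (1 - X ^ 2) ^ (m + 1) * oddSeries (lastLabelSum y D m) =
        leadFactor y (m + 1) (numRuns D m) (numDes D m) *
          (if numRuns D m % 2 = 1 then 1 else X) ∧
      (1 - X ^ 2) ^ (m + 1) * evenSeries (lastLabelSum y D m) =
        leadFactor y (m + 1) (numRuns D m) (numDes D m) *
          (if numRuns D m % 2 = 1 then C y * X else C y) := by
  induction m with
  | zero =>
    simp only [numRuns, numDes, leadFactor]
    constructor <;> ext v <;> rw [zero_add, pow_one, sub_mul, one_mul, map_sub]
    · rcases v with _ | _ | v
      · simp [oddSeries, coeff_X_pow_mul']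
      · simp [oddSeries, coeff_X_pow_mul', lastLabelSum, labelWeight]
      · rw [coeff_succ_X_sq_mul]
        rcases v with _ | v
        · simp [oddSeries, coeff_X]
        · have h1 : (v + 1 + 1 + 1) % 2 = (v + 1) % 2 := by omega
          simp [oddSeries, lastLabelSum, labelWeight, coeff_X, h1]
    · have h2 : (X : PowerSeries R) * (C y * X) = C y * X ^ 2 := by ring
      simp only [pow_one, Nat.sub_self, pow_zero, mul_one, if_true,
        Nat.reduceDiv, Nat.sub_zero, Nat.reduceAdd, h2, coeff_C_mul]
      rcases v with _ | _ | v
      · simp [evenSeries, coeff_X_pow_mul', lastLabelSum, coeff_X_pow]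
      · simp [evenSeries, coeff_X_pow_mul', coeff_X_pow]
      · rw [coeff_succ_X_sq_mul]
        rcases v with _ | v
        · simp [evenSeries, lastLabelSum, labelWeight]
        · have h1 : (v + 1 + 1 + 1) % 2 = (v + 1) % 2 := by omega
          simp [evenSeries, lastLabelSum, labelWeight, coeff_X_pow, h1]
  | succ m ih =>
    obtain ⟨ih1, ih2⟩ := ih
    have hb := numRuns_numDes_bounds D m
    have hp := numRuns_pos D m
    have hodd := one_sub_sq_mul_oddSeries (lastLabelSum y D m)
    have heven := one_sub_sq_mul_evenSeries (lastLabelSum y D m)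
    set u := numRuns D m with hu
    set d := numDes D m with hd
    clear_value u
    -- This removes the truncated subtraction from the exponent `u - 1` of `1 + y`.
    obtain ⟨v, rfl⟩ : ∃ v, u = v + 1 := ⟨u - 1, by omega⟩
    cases hD : D m
    · obtain ⟨h1, h2⟩ := series_of_ascent y D m hD
      have key : (1 - X ^ 2) ^ (m + 1 + 1) * oddSeries (partialSum (lastLabelSum y D m)) =
          leadFactor y (m + 1 + 1) (numRuns D (m + 1)) (numDes D (m + 1)) := by
        rw [pow_succ, mul_assoc, hodd, mul_add, mul_left_comm, ih1, ih2, numRuns, numDes, ← hu,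
          ← hd, hD]
        rcases Nat.mod_two_eq_zero_or_one (v + 1) with h | h
        · have e1 : m + 1 + 1 - d - (v + 1 + 1 + 1) / 2 = m + 1 - d - (v + 1 + 1) / 2 := by omega
          have e2 : d - (v + 1 + 1) / 2 = d - (v + 1) / 2 := by omega
          simp only [leadFactor, h, decide_false, zero_ne_one, if_true, if_false, e1, e2,
            Nat.add_sub_cancel, Bool.false_eq_true]
          ring
        · have e1 : m + 1 + 1 - d - (v + 1 + 1) / 2 = m + 1 - d - (v + 1 + 1) / 2 + 1 := by omega
          simp only [leadFactor, h, decide_true, if_true, if_false, e1,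
            Nat.add_sub_cancel, Bool.false_eq_true]
          ring
      have hpar : numRuns D (m + 1) % 2 = 1 := by
        have := numRuns_parity D m
        simpa [hD] using this
      rw [h1, h2, if_pos hpar, if_pos hpar, ← key]
      constructor <;> ring
    · obtain ⟨h1, h2⟩ := series_of_descent y D m hD
      have key : (1 - X ^ 2) ^ (m + 1 + 1) * evenSeries (partialSum (lastLabelSum y D m)) =
          leadFactor y (m + 1 + 1) (numRuns D (m + 1)) (numDes D (m + 1)) := by
        rw [pow_succ, mul_assoc, heven, mul_add, mul_left_comm, ih1, ih2, numRuns, numDes, ← hu,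
          ← hd, hD]
        rcases Nat.mod_two_eq_zero_or_one (v + 1) with h | h
        · have e1 : m + 1 + 1 - (d + 1) - (v + 1 + 1) / 2 = m + 1 - d - (v + 1 + 1) / 2 := by omega
          have e2 : d + 1 - (v + 1) / 2 = d - (v + 1) / 2 + 1 := by omega
          simp only [leadFactor, h, decide_false, zero_ne_one, if_true, if_false, e1, e2,
            Nat.add_sub_cancel, Bool.true_eq_false]
          ring
        · have e1 : m + 1 + 1 - (d + 1) - (v + 1 + 1 + 1) / 2 = m + 1 - d - (v + 1 + 1) / 2 := by
            omega
          have e2 : d + 1 - (v + 1 + 1) / 2 = d - (v + 1) / 2 := by omega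
          simp only [leadFactor, h, decide_true, if_true, e1, e2,
            Nat.add_sub_cancel]
          ring
      have hpar : ¬ numRuns D (m + 1) % 2 = 1 := by
        have := numRuns_parity D m
        simpa [hD] using this
      rw [h1, h2, if_neg hpar, if_neg hpar, ← key]
      constructor <;> ring

open PowerSeries in
/-- The generating function of the weights of the compatible labelings with bounded labels. -/
theorem series_labelSum (D : ℕ → Bool) (m : ℕ) :
    (1 - X) * (1 - X ^ 2) ^ (m + 1) * mk (partialSum (lastLabelSum y D m)) =
      leadFactor y (m + 1) (numRuns D m) (numDes D m) *
        (if numRuns D m % 2 = 1 then 1 + C y * X else C y + X) := by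
  obtain ⟨h1, h2⟩ := series_lastLabelSum y D m
  rw [mul_comm (1 - X), mul_assoc, one_sub_mul_partialSum, mul_add, h1, h2]
  split_ifs <;> ring

end Transfer

/-! ### Up-down runs and descents from the descent pattern -/

/-- The descent pattern of a permutation. -/
def pattern (p : Permutation) (i : ℕ) : Bool :=
  decide (∃ h : i + 1 < p.1.length, p.1[i + 1] < p.1[i])

theorem pattern_eq_true {p : Permutation} {i : ℕ} (h : i + 1 < p.1.length) :
    pattern p i = true ↔ p.1[i + 1] < p.1[i] := by
  simp [pattern, h]

theorem pattern_eq_false {p : Permutation} {i : ℕ} (h : i + 1 < p.1.length) :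
    pattern p i = false ↔ p.1[i] < p.1[i + 1] := by
  have h1 : p.1[i] ≠ p.1[i + 1] := fun h2 => by
    have := (p.2.getElem_inj_iff).1 h2
    omega
  rw [← Bool.not_eq_true, pattern_eq_true h, not_lt]
  exact ⟨fun h2 => lt_of_le_of_ne h2 h1, le_of_lt⟩

theorem numDes_eq_card (D : ℕ → Bool) (m : ℕ) :
    numDes D m = ((Finset.range m).filter (fun i => D i = true)).card := by
  induction m with
  | zero => simp [numDes]
  | succ m ih =>
    rw [numDes, Finset.range_add_one, Finset.filter_insert, ih]
    split_ifs <;> simp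

theorem des_eq_numDes (p : Permutation) : des p = numDes (pattern p) (p.len - 1) := by
  rw [numDes_eq_card, des]
  congr 1
  ext i
  simp only [Finset.mem_filter, Finset.mem_range, pattern, decide_eq_true_eq, Permutation.len]
  constructor
  · rintro ⟨h1, h2, h3⟩
    exact ⟨by omega, h2, h3⟩
  · rintro ⟨h1, h2, h3⟩
    exact ⟨by omega, h2, h3⟩

/-- The descent pattern is constant on the steps from position `i` to position `j`. -/
def ConstOn (D : ℕ → Bool) (i j : ℕ) : Prop := ∃ b, ∀ m, i ≤ m → m < j → D m = b

theorem ConstOn.mono {D : ℕ → Bool} {i j i' j' : ℕ} (h : ConstOn D i j) (hi : i ≤ i')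
    (hj : j' ≤ j) : ConstOn D i' j' := by
  obtain ⟨b, hb⟩ := h
  exact ⟨b, fun m h1 h2 => hb m (by omega) (by omega)⟩

theorem ConstOn.eq {D : ℕ → Bool} {i j a b : ℕ} (h : ConstOn D i j) (ha : i ≤ a) (ha' : a < j)
    (hb : i ≤ b) (hb' : b < j) : D a = D b := by
  obtain ⟨c, hc⟩ := h
  rw [hc a ha ha', hc b hb hb']

theorem constOn_succ (D : ℕ → Bool) (i : ℕ) : ConstOn D i (i + 1) :=
  ⟨D i, fun m h1 h2 => by rw [show m = i by omega]⟩

theorem incOn_iff {p : Permutation} {i j : ℕ} (hj : j < p.1.length) :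
    IncOn p i j ↔ ∀ m, i ≤ m → m < j → pattern p m = false := by
  constructor
  · intro h m h1 h2
    rw [pattern_eq_false (by omega)]
    exact h m (m + 1) _ _ h1 (by omega) (by omega)
  · intro h a b ha hb h1 h2 h3
    induction b, h2 using Nat.le_induction with
    | base => exact (pattern_eq_false hb).1 (h a h1 (by omega))
    | succ b h2 ih =>
      exact (ih (by omega) (by omega)).trans ((pattern_eq_false hb).1 (h b (by omega) (by omega)))

theorem decOn_iff {p : Permutation} {i j : ℕ} (hj : j < p.1.length) :
    DecOn p i j ↔ ∀ m, i ≤ m → m < j → pattern p m = true := by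
  constructor
  · intro h m h1 h2
    rw [pattern_eq_true (by omega)]
    exact h m (m + 1) _ _ h1 (by omega) (by omega)
  · intro h a b ha hb h1 h2 h3
    induction b, h2 using Nat.le_induction with
    | base => exact (pattern_eq_true hb).1 (h a h1 (by omega))
    | succ b h2 ih =>
      exact ((pattern_eq_true hb).1 (h b (by omega) (by omega))).trans (ih (by omega) (by omega))

theorem monoSegment_iff {p : Permutation} {i j : ℕ} :
    MonoSegment p i j ↔ i ≤ j ∧ j < p.1.length ∧ ConstOn (pattern p) i j := by
  rw [MonoSegment]
  refine and_congr_right fun _ => and_congr_right fun hj => ?_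
  rw [incOn_iff hj, decOn_iff hj, ConstOn, Bool.exists_bool]

/-- The positions at which a birun starts. -/
def IsRunStart (D : ℕ → Bool) (i : ℕ) : Prop := i = 0 ∨ D i ≠ D (i - 1)

instance (D : ℕ → Bool) : DecidablePred (IsRunStart D) := fun _ => by
  unfold IsRunStart; infer_instance

/-- With at least two letters every birun contains a step, so it starts before the last position; it
starts either at `0` or where the direction changes. -/
theorem image_fst_isBirun {p : Permutation} (h : 2 ≤ p.1.length) :
    Prod.fst '' {s : ℕ × ℕ | IsBirun p s.1 s.2} =
      ((Finset.range (p.1.length - 1)).filter (IsRunStart (pattern p)) : Set ℕ) := by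
  ext i
  simp only [Set.mem_image, Set.mem_ofPred_eq, Prod.exists, exists_and_right, exists_eq_right,
    Finset.coe_filter, Finset.mem_range]
  constructor
  · rintro ⟨j, h1, h2⟩
    simp only [monoSegment_iff] at h1 h2
    obtain ⟨h3, h4, h5⟩ := h1
    -- The last letter alone is not maximal, since it extends to the left.
    have h6 : i < p.1.length - 1 := by
      by_contra h7
      have h8 := h2 (i - 1) j (by omega) le_rfl ⟨by omega, h4, by
        rw [show j = i - 1 + 1 by omega]; exact constOn_succ _ _⟩
      omega
    refine ⟨h6, ?_⟩
    by_contra h7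
    simp only [IsRunStart, not_or, not_not] at h7
    have h9 : i < j := by
      by_contra h10
      have h8 := h2 i (i + 1) le_rfl (by omega) ⟨by omega, by omega, constOn_succ _ _⟩
      omega
    have h8 := h2 (i - 1) j (by omega) le_rfl ⟨by omega, h4, pattern p i, fun m h11 h12 => by
      by_cases h13 : m = i - 1
      · rw [h13, h7.2]
      · exact h5.eq (by omega) (by omega) le_rfl h9⟩
    omega
  · rintro ⟨h1, h2⟩
    classical
    -- The birun starting at `i` ends where the longest constant stretch of the pattern from `i`
    -- ends.
    set j := Nat.findGreatest (ConstOn (pattern p) i) (p.1.length - 1) with hj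
    have h3 : i + 1 ≤ j := Nat.le_findGreatest (by omega) (constOn_succ _ _)
    have h4 : j ≤ p.1.length - 1 := Nat.findGreatest_le _
    have h5 : ConstOn (pattern p) i j :=
      Nat.findGreatest_spec (P := ConstOn (pattern p) i) (m := i + 1) (by omega) (constOn_succ _ _)
    refine ⟨j, ?_, ?_⟩
    · rw [monoSegment_iff]
      exact ⟨by omega, by omega, h5⟩
    · intro i' j' hi' hj' h6
      rw [monoSegment_iff] at h6
      have h7 : j' ≤ j := Nat.le_findGreatest (by omega) (h6.2.2.mono hi' le_rfl)
      refine ⟨?_, by omega⟩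
      by_contra h8
      rcases h2 with h2 | h2
      · omega
      · exact h2 (h6.2.2.eq (by omega) (by omega) (by omega) (by omega))

/-- Biruns can be counted by their starts: of two with the same start, the longer would extend the
shorter. -/
theorem br_eq_card {p : Permutation} (h : 2 ≤ p.1.length) :
    br p = ((Finset.range (p.1.length - 1)).filter (IsRunStart (pattern p))).card := by
  rw [← Set.ncard_coe_finset, ← image_fst_isBirun h, br, Set.InjOn.ncard_image]
  rintro ⟨i, j⟩ h1 ⟨i', j'⟩ h2 h3
  obtain rfl : i = i' := h3
  simp only [Set.mem_ofPred_eq] at h1 h2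
  rcases le_total j j' with h4 | h4
  · rw [(h1.2 i j' le_rfl h4 h2.1).2]
  · rw [(h2.2 i j le_rfl h4 h1.1).2]

/-- After an initial descent the first letter alone is an extra up run, which is the additional `1`
in `udr`. -/
theorem numRuns_eq_card (D : ℕ → Bool) (m : ℕ) :
    numRuns D (m + 1) = ((Finset.range (m + 1)).filter (IsRunStart D)).card +
      if D 0 then 1 else 0 := by
  induction m with
  | zero => cases h : D 0 <;> simp [numRuns, h, Finset.filter_singleton, IsRunStart]
  | succ m ih =>
    rw [numRuns, Finset.range_add_one, Finset.filter_insert, numRuns_parity, ih]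
    have h1 : IsRunStart D (m + 1) ↔ D (m + 1) = !D m := by
      simp only [IsRunStart, Nat.add_one_ne_zero, false_or, Nat.add_sub_cancel]
      cases D (m + 1) <;> cases D m <;> simp
    simp only [h1]
    split_ifs <;> simp

theorem br_of_length_one {p : Permutation} (h : p.1.length = 1) : br p = 1 := by
  have h1 : {s : ℕ × ℕ | IsBirun p s.1 s.2} = {(0, 0)} := by
    ext ⟨i, j⟩
    simp only [Set.mem_ofPred_eq, Set.mem_singleton_iff, Prod.mk.injEq, IsBirun, monoSegment_iff]
    constructor
    · rintro ⟨h2, -⟩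
      omega
    · rintro ⟨rfl, rfl⟩
      exact ⟨⟨le_rfl, by omega, true, fun m _ h3 => by omega⟩, fun i' j' _ _ h3 => by omega⟩
  rw [br, h1, Set.ncard_singleton]

theorem udr_of_length_zero {p : Permutation} (h : p.len = 0) : udr p = 0 := by
  rw [Permutation.len] at h
  have h1 : {s : ℕ × ℕ | IsBirun p s.1 s.2} = ∅ := by
    ext ⟨i, j⟩
    simp only [Set.mem_ofPred_eq, IsBirun, MonoSegment, h, Set.mem_empty_iff_false, iff_false]
    intro h1
    omega
  have h2 : ¬ InitialDescent p := fun ⟨h3, _⟩ => by omega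
  rw [udr, if_neg h2, br, h1, Set.ncard_empty]

theorem udr_eq_numRuns {p : Permutation} (h : 1 ≤ p.len) :
    udr p = numRuns (pattern p) (p.len - 1) := by
  rw [Permutation.len] at *
  have h1 : InitialDescent p ↔ pattern p 0 = true := by
    simp [InitialDescent, pattern]
  rw [udr]
  simp only [h1]
  by_cases h2 : p.1.length = 1
  · have h3 : pattern p 0 = false := by simp [pattern, h2]
    rw [br_of_length_one h2, h2, h3]
    simp [numRuns]
  · obtain ⟨m, hm⟩ : ∃ m, p.1.length - 1 = m + 1 := ⟨p.1.length - 2, by omega⟩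
    rw [br_eq_card (by omega), hm, numRuns_eq_card]

theorem des_of_length_zero {p : Permutation} (h : p.len = 0) : des p = 0 := by
  rw [des_eq_numDes, h]; rfl

theorem admissible_udr_des (p : Permutation) : Admissible p.len (udr p) (des p) := by
  rcases Nat.eq_zero_or_pos p.len with h | h
  · exact Or.inl ⟨h, udr_of_length_zero h, des_of_length_zero h⟩
  · have h1 := admissible_numRuns_numDes (pattern p) (p.len - 1)
    rwa [Nat.sub_add_cancel h, ← udr_eq_numRuns h, ← des_eq_numDes] at h1

/-! ### Permutations with a given descent pattern -/

/-- The letters of a permutation with descent pattern `D`: each letter is larger or smaller than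
all of the previous ones. -/
def patternLetter (D : ℕ → Bool) (n i : ℕ) : ℕ+ :=
  ⟨if i ≠ 0 ∧ D (i - 1) = true then n + 1 - min i n else n + 1 + i, by split_ifs <;> omega⟩

theorem coe_patternLetter (D : ℕ → Bool) (n i : ℕ) : (patternLetter D n i : ℕ) =
    if i ≠ 0 ∧ D (i - 1) = true then n + 1 - min i n else n + 1 + i := rfl

/-- The letters spread out around `n + 1`: the letter at position `i` is `n + 1 + i` after an ascent
and `n + 1 - i` after a descent. The truncation `min i n` only matters for positions that are not
used. -/
theorem exists_perm_pattern (D : ℕ → Bool) (n : ℕ) :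
    ∃ p : Permutation, p.len = n ∧ ∀ i, i + 1 < n → pattern p i = D i := by
  have hinj : ((List.range n).map (patternLetter D n)).Nodup := by
    refine List.Nodup.map_on ?_ List.nodup_range
    intro i hi j hj h
    rw [List.mem_range] at hi hj
    have h1 : (patternLetter D n i : ℕ) = patternLetter D n j := by rw [h]
    rw [coe_patternLetter, coe_patternLetter] at h1
    split_ifs at h1 <;> omega
  refine ⟨⟨_, hinj⟩, by simp [Permutation.len], fun i hi => ?_⟩
  rw [Bool.eq_iff_iff, pattern_eq_true (by simpa using hi)]
  simp only [List.getElem_map, List.getElem_range, ← PNat.coe_lt_coe, coe_patternLetter,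
    Nat.add_sub_cancel]
  cases hD : D i
  · simp only [Bool.false_eq_true, and_false, if_false, iff_false]
    split_ifs <;> omega
  · simp only [ne_eq, Nat.add_one_ne_zero, not_false_eq_true, and_self, if_true, iff_true]
    split_ifs <;> omega

theorem exists_perm_of_admissible {n u d : ℕ} (h : Admissible n u d) :
    ∃ p : Permutation, p.len = n ∧ udr p = u ∧ des p = d := by
  rcases n with _ | m
  · refine ⟨⟨[], List.nodup_nil⟩, rfl, ?_, ?_⟩
    · rw [udr_of_length_zero rfl]; unfold Admissible at h; omega
    · rw [des_of_length_zero rfl]; unfold Admissible at h; omega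
  · obtain ⟨D, hu, hd⟩ := exists_pattern h
    obtain ⟨p, hp, hD⟩ := exists_perm_pattern D (m + 1)
    refine ⟨p, hp, ?_, ?_⟩
    · rw [udr_eq_numRuns (by omega), ← hu, hp]
      exact numRuns_congr fun i hi => hD i (by omega)
    · rw [des_eq_numDes, ← hd, hp]
      exact numDes_congr fun i hi => hD i (by omega)

/-! ### Compatible labelings -/

/-- The key by which a labeling sorts letters: letters with the same label are sorted increasingly
if the label is odd, decreasingly if it is even. -/
def labelKey (f : ℕ+ →₀ ℕ) (a : ℕ+) : ℕ ×ₗ ℤ :=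
  toLex (f a, if f a % 2 = 1 then (a : ℤ) else -(a : ℤ))

theorem labelKey_lt {f : ℕ+ →₀ ℕ} {a b : ℕ+} :
    labelKey f a < labelKey f b ↔
      f a < f b ∨ (f a = f b ∧ ((f b % 2 = 1 ∧ a < b) ∨ (¬ f b % 2 = 1 ∧ b < a))) := by
  rw [labelKey, labelKey, Prod.Lex.toLex_lt_toLex]
  refine or_congr_right (and_congr_right fun h => ?_)
  simp only at h
  rw [h]
  split_ifs with h1 <;> simp [h1]

theorem labelKey_injective (f : ℕ+ →₀ ℕ) : Function.Injective (labelKey f) := by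
  intro a b h
  rcases lt_trichotomy a b with h1 | h1 | h1
  · have h2 : f a = f b := congrArg (fun z => (ofLex z).1) h
    by_cases h3 : f b % 2 = 1
    · exact absurd h (labelKey_lt.2 (Or.inr ⟨h2, Or.inl ⟨h3, h1⟩⟩)).ne
    · exact absurd h (labelKey_lt.2 (Or.inr ⟨h2.symm, Or.inr ⟨h2 ▸ h3, h1⟩⟩)).ne'
  · exact h1
  · have h2 : f a = f b := congrArg (fun z => (ofLex z).1) h
    by_cases h3 : f b % 2 = 1
    · exact absurd h (labelKey_lt.2 (Or.inr ⟨h2.symm, Or.inl ⟨h2 ▸ h3, h1⟩⟩)).ne'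
    · exact absurd h (labelKey_lt.2 (Or.inr ⟨h2, Or.inr ⟨h3, h1⟩⟩)).ne

theorem labelKey_congr {f g : ℕ+ →₀ ℕ} {a : ℕ+} (h : f a = g a) : labelKey f a = labelKey g a := by
  rw [labelKey, labelKey, h]

/-- A labeling is compatible with a sequence of letters if it sorts the letters in this order. -/
def Compatible (f : ℕ+ →₀ ℕ) (l : List ℕ+) : Prop :=
  l.Pairwise fun a b => labelKey f a < labelKey f b

theorem Compatible.congr {f g : ℕ+ →₀ ℕ} {l : List ℕ+} (h : ∀ a ∈ l, f a = g a)
    (hf : Compatible f l) : Compatible g l := by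
  refine List.Pairwise.imp_of_mem ?_ hf
  intro a b ha hb hab
  rwa [← labelKey_congr (h a ha), ← labelKey_congr (h b hb)]

theorem compatible_congr {f g : ℕ+ →₀ ℕ} {l : List ℕ+} (h : ∀ a ∈ l, f a = g a) :
    Compatible f l ↔ Compatible g l :=
  ⟨Compatible.congr h, Compatible.congr fun a ha => (h a ha).symm⟩

theorem Compatible.eq_of_perm {f : ℕ+ →₀ ℕ} {l m : List ℕ+} (hl : Compatible f l)
    (hm : Compatible f m) (h : l.Perm m) : l = m :=
  List.Perm.eq_of_pairwise (fun _ _ _ _ h1 h2 => absurd h1 h2.asymm) hl hm h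

theorem exists_compatible (f : ℕ+ →₀ ℕ) {l : List ℕ+} (hl : l.Nodup) :
    ∃ m : List ℕ+, m.Perm l ∧ Compatible f m := by
  classical
  let r : ℕ+ → ℕ+ → Prop := fun a b => labelKey f a ≤ labelKey f b
  have : Std.Total r := ⟨fun a b => le_total _ _⟩
  have : IsTrans ℕ+ r := ⟨fun a b c => le_trans⟩
  have hp := List.perm_insertionSort r l
  refine ⟨l.insertionSort r, hp, ?_⟩
  have h1 := List.pairwise_insertionSort r l
  have h2 : (l.insertionSort r).Nodup := hp.nodup_iff.2 hl
  exact (h1.and h2).imp fun h => lt_of_le_of_ne h.1 fun h3 => h.2 (labelKey_injective f h3)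

/-- A labeling compatible with two disjoint permutations is compatible with a unique shuffle. -/
theorem existsUnique_shuffle_compatible {p q : Permutation} (h : DisjointPerm p q)
    {f : ℕ+ →₀ ℕ} (hp : Compatible f p.1) (hq : Compatible f q.1) :
    ∃! r : Permutation, r ∈ shuffles p q ∧ Compatible f r.1 := by
  have hn : (p.1 ++ q.1).Nodup :=
    List.nodup_append.2 ⟨p.2, q.2, fun a ha b hb hab => h a ha (hab ▸ hb)⟩
  obtain ⟨m, hm, hc⟩ := exists_compatible f hn
  -- The letters of `s`, taken in the sorted order `m`, form a sorted list; a set of letters has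
  -- only one, so it is `s`.
  have key : ∀ s : Permutation, (∀ a ∈ s.1, a ∈ p.1 ++ q.1) → Compatible f s.1 →
      List.Sublist s.1 m := by
    intro s hs hcs
    have h1 : m.filter (fun a => decide (a ∈ s.1)) = s.1 := by
      refine Compatible.eq_of_perm (hc.filter _) hcs ?_
      refine (List.perm_ext_iff_of_nodup ((hm.nodup_iff.2 hn).filter _) s.2).2 fun a => ?_
      rw [List.mem_filter, hm.mem_iff, decide_eq_true_eq]
      exact ⟨fun h => h.2, fun h => ⟨hs a h, h⟩⟩
    rw [← h1]
    exact List.filter_sublist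
  refine ⟨⟨m, hm.nodup_iff.2 hn⟩, ⟨mem_shuffles_iff.2 ⟨hm,
    key p (fun a ha => List.mem_append_left _ ha) hp,
    key q (fun a ha => List.mem_append_right _ ha) hq⟩, hc⟩, ?_⟩
  rintro r ⟨h1, h2⟩
  exact Subtype.ext (h2.eq_of_perm hc ((mem_shuffles_iff.1 h1).1.trans hm.symm))

/-! ### Weighted sums over labelings and their products -/

section LabelSum

variable {R : Type*} [CommRing R] (y : R)

/-- The labelings of a set of letters by the numbers `1, ..., k`. -/
noncomputable def labelings (s : Finset ℕ+) (k : ℕ) : Finset (ℕ+ →₀ ℕ) :=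
  s.finsupp fun _ => Finset.Icc 1 k

theorem mem_labelings {s : Finset ℕ+} {k : ℕ} {f : ℕ+ →₀ ℕ} :
    f ∈ labelings s k ↔ (∀ a ∉ s, f a = 0) ∧ ∀ a ∈ s, 1 ≤ f a ∧ f a ≤ k := by
  rw [labelings, Finset.mem_finsupp_iff]
  simp only [Finset.mem_Icc]
  refine and_congr_left fun _ => ?_
  constructor
  · intro h a ha
    by_contra h1
    exact ha (h (Finsupp.mem_support_iff.2 h1))
  · intro h a ha
    by_contra h1
    exact Finsupp.mem_support_iff.1 ha (h a h1)

/-- The weight of a labeling of a set of letters. -/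
def totalWeight (s : Finset ℕ+) (f : ℕ+ →₀ ℕ) : R := ∏ a ∈ s, labelWeight y (f a)

theorem totalWeight_congr {s : Finset ℕ+} {f g : ℕ+ →₀ ℕ} (h : ∀ a ∈ s, f a = g a) :
    totalWeight y s f = totalWeight y s g :=
  Finset.prod_congr rfl fun a ha => by rw [h a ha]

open Classical in
/-- The total weight of the labelings by `1, ..., k` that are compatible with a sequence. -/
noncomputable def labelSum (l : List ℕ+) (k : ℕ) : R :=
  ∑ f ∈ labelings l.toFinset k, if Compatible f l then totalWeight y l.toFinset f else 0

/-- Labelings vanish off their set of letters, so pairs are glued by addition and separated by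
restriction. The hypothesis `hF` says that `F` sees only the labels on `s` and on `t`. -/
theorem sum_labelings_union {s t : Finset ℕ+} (h : Disjoint s t) (k : ℕ)
    (F : (ℕ+ →₀ ℕ) → (ℕ+ →₀ ℕ) → R)
    (hF : ∀ f g f' g', (∀ a ∈ s, f a = f' a) → (∀ a ∈ t, g a = g' a) → F f g = F f' g') :
    ∑ f ∈ labelings s k, ∑ g ∈ labelings t k, F f g = ∑ f ∈ labelings (s ∪ t) k, F f f := by
  classical
  rw [← Finset.sum_product']
  have hst : ∀ a ∈ s, a ∉ t := fun a ha => Finset.disjoint_left.1 h ha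
  refine Finset.sum_nbij' (fun z => z.1 + z.2)
    (fun f => (f.filter (· ∈ s), f.filter (· ∈ t))) ?_ ?_ ?_ ?_ ?_
  · rintro ⟨f, g⟩ hz
    rw [Finset.mem_product, mem_labelings, mem_labelings] at hz
    obtain ⟨⟨h1, h2⟩, h3, h4⟩ := hz
    rw [mem_labelings]
    constructor
    · intro a ha
      rw [Finset.mem_union, not_or] at ha
      simp [h1 a ha.1, h3 a ha.2]
    · intro a ha
      by_cases h5 : a ∈ s
      · simpa [h3 a (hst a h5)] using h2 a h5
      · simpa [h1 a h5] using h4 a ((Finset.mem_union.1 ha).resolve_left h5)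
  · intro f hf
    rw [mem_labelings] at hf
    rw [Finset.mem_product, mem_labelings, mem_labelings]
    refine ⟨⟨fun a ha => Finsupp.filter_apply_neg _ _ ha, fun a ha => ?_⟩,
      fun a ha => Finsupp.filter_apply_neg _ _ ha, fun a ha => ?_⟩
    · simpa [Finsupp.filter_apply, ha] using hf.2 a (Finset.mem_union_left _ ha)
    · simpa [Finsupp.filter_apply, ha] using hf.2 a (Finset.mem_union_right _ ha)
  · rintro ⟨f, g⟩ hz
    rw [Finset.mem_product, mem_labelings, mem_labelings] at hz
    obtain ⟨⟨h1, h2⟩, h3, h4⟩ := hz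
    refine Prod.ext ?_ ?_ <;> ext a <;> simp only [Finsupp.filter_apply, Finsupp.add_apply]
    · split_ifs with ha
      · rw [h3 a (hst a ha), add_zero]
      · exact (h1 a ha).symm
    · split_ifs with ha
      · rw [h1 a fun h5 => hst a h5 ha, zero_add]
      · exact (h3 a ha).symm
  · intro f hf
    rw [mem_labelings] at hf
    ext a
    simp only [Finsupp.filter_apply, Finsupp.add_apply]
    by_cases h5 : a ∈ s
    · simp [h5, hst a h5]
    · by_cases h6 : a ∈ t
      · simp [h5, h6]
      · simp [h5, h6, hf.1 a (by simp [h5, h6])]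
  · rintro ⟨f, g⟩ hz
    rw [Finset.mem_product, mem_labelings, mem_labelings] at hz
    obtain ⟨⟨h1, h2⟩, h3, h4⟩ := hz
    refine hF _ _ _ _ (fun a ha => ?_) (fun a ha => ?_)
    · simp [h3 a (hst a ha)]
    · simp [h1 a fun h5 => hst a h5 ha]

/-- Both sides are sums over labelings `f` of all the letters. If `f` is compatible with both
factors, exactly one shuffle contributes its weight; otherwise none does, since compatibility passes
to subsequences. -/
theorem labelSum_mul_labelSum {p q : Permutation} (h : DisjointPerm p q) (k : ℕ) :
    labelSum y p.1 k * labelSum y q.1 k = ∑ r ∈ shuffles p q, labelSum y r.1 k := by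
  classical
  have hd : Disjoint p.1.toFinset q.1.toFinset := by
    rw [Finset.disjoint_left]
    intro a ha hb
    exact h a (List.mem_toFinset.1 ha) (List.mem_toFinset.1 hb)
  have hr : ∀ r ∈ shuffles p q, r.1.toFinset = p.1.toFinset ∪ q.1.toFinset := by
    intro r hr
    rw [← List.toFinset_append]
    exact List.toFinset_eq_of_perm _ _ (mem_shuffles_iff.1 hr).1
  rw [labelSum, labelSum, Finset.sum_mul_sum, sum_labelings_union hd]
  · have h1 : ∀ r ∈ shuffles p q, labelSum y r.1 k =
        ∑ f ∈ labelings (p.1.toFinset ∪ q.1.toFinset) k, if Compatible f r.1 then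
          totalWeight y (p.1.toFinset ∪ q.1.toFinset) f else 0 := by
      intro r h2
      rw [labelSum, hr r h2]
    rw [Finset.sum_congr rfl h1, Finset.sum_comm]
    refine Finset.sum_congr rfl fun f _ => ?_
    by_cases h2 : Compatible f p.1 ∧ Compatible f q.1
    · obtain ⟨r, ⟨h3, h4⟩, h5⟩ := existsUnique_shuffle_compatible h h2.1 h2.2
      rw [if_pos h2.1, if_pos h2.2, Finset.sum_eq_single_of_mem r h3, if_pos h4, totalWeight,
        totalWeight, totalWeight, Finset.prod_union hd]
      intro r' h6 h7
      exact if_neg fun h8 => h7 (h5 r' ⟨h6, h8⟩)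
    · rw [Finset.sum_eq_zero]
      · by_cases h3 : Compatible f p.1
        · rw [if_neg fun h4 => h2 ⟨h3, h4⟩, mul_zero]
        · rw [if_neg h3, zero_mul]
      · intro r h3
        refine if_neg fun h4 => h2 ⟨?_, ?_⟩
        · exact List.Pairwise.sublist (mem_shuffles_iff.1 h3).2.1 h4
        · exact List.Pairwise.sublist (mem_shuffles_iff.1 h3).2.2 h4
  · intro f g f' g' h1 h2
    rw [totalWeight_congr y h1, totalWeight_congr y h2,
      compatible_congr fun a ha => h1 a (List.mem_toFinset.2 ha),
      compatible_congr fun a ha => h2 a (List.mem_toFinset.2 ha)]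

theorem labelSum_nil (k : ℕ) : labelSum y [] k = 1 := by
  have h1 : labelings ([] : List ℕ+).toFinset k = {0} := by
    ext f
    rw [mem_labelings, Finset.mem_singleton]
    simp [Finsupp.ext_iff]
  rw [labelSum, h1, Finset.sum_singleton, if_pos (by exact List.Pairwise.nil), totalWeight]
  simp

end LabelSum

/-! ### The recursion on the last letter and its label -/

section LastLabel

variable {R : Type*} [CommRing R] (y : R)

open Classical in
/-- The total weight of the labelings by `1, ..., k` that are compatible with a sequence and have
the label `v` at a given letter. -/
noncomputable def labelSumAt (l : List ℕ+) (a : ℕ+) (k v : ℕ) : R :=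
  ∑ f ∈ labelings l.toFinset k,
    if Compatible f l ∧ f a = v then totalWeight y l.toFinset f else 0

theorem labelSum_eq_sum_labelSumAt {l : List ℕ+} {a : ℕ+} (ha : a ∈ l) (k : ℕ) :
    labelSum y l k = ∑ v ∈ Finset.range (k + 1), labelSumAt y l a k v := by
  simp only [labelSum, labelSumAt]
  rw [Finset.sum_comm]
  refine Finset.sum_congr rfl fun f hf => ?_
  have h1 := (mem_labelings.1 hf).2 a (List.mem_toFinset.2 ha)
  by_cases h2 : Compatible f l
  · simp only [h2, true_and, if_true]
    rw [Finset.sum_ite_eq, if_pos (Finset.mem_range.2 (by omega))]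
  · simp [h2]

theorem labelSumAt_zero {l : List ℕ+} {a : ℕ+} (ha : a ∈ l) (k : ℕ) :
    labelSumAt y l a k 0 = 0 := by
  refine Finset.sum_eq_zero fun f hf => if_neg fun h => ?_
  have h1 := (mem_labelings.1 hf).2 a (List.mem_toFinset.2 ha)
  omega

theorem sum_labelings_singleton (b : ℕ+) {k v : ℕ} (hv : 1 ≤ v) (hvk : v ≤ k)
    (F : (ℕ+ →₀ ℕ) → R) :
    ∑ g ∈ labelings {b} k, (if g b = v then F g else 0) = F (Finsupp.single b v) := by
  rw [Finset.sum_eq_single_of_mem (Finsupp.single b v), if_pos (by simp)]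
  · rw [mem_labelings]
    refine ⟨fun a ha => Finsupp.single_eq_of_ne (by simpa using ha), fun a ha => ?_⟩
    rw [Finset.mem_singleton.1 ha, Finsupp.single_eq_same]
    exact ⟨hv, hvk⟩
  · intro g hg hne
    refine if_neg fun h => hne ?_
    ext a
    by_cases ha : a = b
    · rw [ha, h, Finsupp.single_eq_same]
    · rw [(mem_labelings.1 hg).1 a (by simpa using ha), Finsupp.single_eq_of_ne ha]

theorem labelSumAt_singleton (b : ℕ+) {k v : ℕ} (hv : 1 ≤ v) (hvk : v ≤ k) :
    labelSumAt y [b] b k v = labelWeight y v := by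
  have h1 : ∀ f : ℕ+ →₀ ℕ, Compatible f [b] := fun f => List.pairwise_singleton _ _
  have h2 : ([b] : List ℕ+).toFinset = {b} := by simp
  simp only [labelSumAt, h1, true_and, h2]
  rw [sum_labelings_singleton b hv hvk, totalWeight, Finset.prod_singleton, Finsupp.single_eq_same]

theorem compatible_snoc_snoc {f : ℕ+ →₀ ℕ} {l : List ℕ+} {a b : ℕ+} :
    Compatible f (l ++ [a] ++ [b]) ↔ Compatible f (l ++ [a]) ∧ labelKey f a < labelKey f b := by
  rw [Compatible, List.pairwise_append]
  simp only [List.pairwise_singleton, List.mem_singleton, forall_eq, true_and]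
  refine and_congr_right fun h => ⟨fun h1 => h1 a (by simp), fun h1 c hc => ?_⟩
  rcases List.mem_append.1 hc with hc | hc
  · exact ((List.pairwise_append.1 h).2.2 c hc a (by simp)).trans h1
  · rwa [List.mem_singleton.1 hc]

/-- By transitivity of the key order, appending `b` with label `v` only restricts the label of its
neighbour `a`. Hence the weight of `b` factors out. -/
theorem labelSumAt_snoc {l : List ℕ+} {a b : ℕ+} (hb : b ∉ l ++ [a]) {k v : ℕ} (hv : 1 ≤ v)
    (hvk : v ≤ k) :
    labelSumAt y (l ++ [a] ++ [b]) b k v = labelWeight y v *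
      ∑ w ∈ Finset.range (if decide (b < a) = decide (v % 2 = 1) then v else v + 1),
        labelSumAt y (l ++ [a]) a k w := by
  classical
  set s := (l ++ [a]).toFinset with hs
  set c := if decide (b < a) = decide (v % 2 = 1) then v else v + 1 with hc
  have hbs : b ∉ s := fun h => hb (List.mem_toFinset.1 h)
  have has : a ∈ s := by simp [hs]
  have hba : b ≠ a := fun h => hbs (h ▸ has)
  have hd : Disjoint s {b} := Finset.disjoint_singleton_right.2 hbs
  have hu : (l ++ [a] ++ [b]).toFinset = s ∪ {b} := by
    rw [List.toFinset_append, ← hs]; simp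
  -- The bound `c` excludes `w = v` exactly for an odd label at a descent or an even label at an
  -- ascent.
  have hkey : ∀ w, (w < v ∨ (w = v ∧ ((v % 2 = 1 ∧ a < b) ∨ (¬ v % 2 = 1 ∧ b < a)))) ↔ w < c := by
    intro w
    rw [hc]
    rcases lt_or_gt_of_ne hba with h1 | h1 <;> by_cases h2 : v % 2 = 1 <;>
      simp [h1, h2, h1.not_gt] <;> omega
  let F : (ℕ+ →₀ ℕ) → (ℕ+ →₀ ℕ) → R := fun f g => if g b = v then
    (if Compatible f (l ++ [a]) ∧ f a < c then totalWeight y s f * labelWeight y v else 0) else 0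
  have hF : ∀ f g f' g', (∀ x ∈ s, f x = f' x) → (∀ x ∈ ({b} : Finset ℕ+), g x = g' x) →
      F f g = F f' g' := by
    intro f g f' g' h1 h2
    simp only [F]
    rw [h1 a has, h2 b (Finset.mem_singleton_self b), totalWeight_congr y h1,
      compatible_congr fun x hx => h1 x (List.mem_toFinset.2 hx)]
  have h1 : labelSumAt y (l ++ [a] ++ [b]) b k v = ∑ f ∈ labelings (s ∪ {b}) k, F f f := by
    rw [labelSumAt, hu]
    refine Finset.sum_congr rfl fun f _ => ?_
    simp only [F]
    by_cases h2 : f b = v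
    · rw [if_pos h2]
      refine if_congr ?_ ?_ rfl
      · rw [compatible_snoc_snoc, labelKey_lt, h2, hkey]
        tauto
      · rw [totalWeight, Finset.prod_union hd, Finset.prod_singleton, h2, totalWeight]
    · rw [if_neg h2, if_neg fun h3 => h2 h3.2]
  rw [h1, ← sum_labelings_union hd k F hF]
  simp only [F, sum_labelings_singleton b hv hvk, labelSumAt]
  rw [Finset.sum_comm, Finset.mul_sum]
  refine Finset.sum_congr rfl fun f _ => ?_
  by_cases h2 : Compatible f (l ++ [a])
  · simp only [h2, true_and]
    rw [Finset.sum_ite_eq]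
    simp only [Finset.mem_range, mul_comm (labelWeight y v), ite_mul, zero_mul, ← hs]
  · simp [h2]

/-- The right side does not involve `k`: labels weakly increase, so a last label `v ≤ k` already
bounds all of them. -/
theorem labelSumAt_take (p : Permutation) {m : ℕ} (hm : m < p.1.length) {k v : ℕ} (hvk : v ≤ k) :
    labelSumAt y (p.1.take (m + 1)) p.1[m] k v = lastLabelSum y (pattern p) m v := by
  induction m generalizing v with
  | zero =>
    have h1 : p.1.take (0 + 1) = [p.1[0]] := by
      rw [← List.take_concat_get' _ _ hm]; simp
    rw [h1, lastLabelSum]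
    split_ifs with hv
    · rw [hv, labelSumAt_zero y (by simp)]
    · exact labelSumAt_singleton y _ (by omega) hvk
  | succ m ih =>
    rcases Nat.eq_zero_or_pos v with rfl | hv
    · rw [lastLabelSum_zero]
      refine labelSumAt_zero y ?_ k
      rw [← List.take_concat_get' _ _ hm]
      exact List.mem_append_right _ (List.mem_singleton_self _)
    · have h1 : p.1.take (m + 1) = p.1.take m ++ [p.1[m]] :=
        (List.take_concat_get' _ _ (by omega)).symm
      have h2 : p.1.take (m + 1 + 1) = p.1.take m ++ [p.1[m]] ++ [p.1[m + 1]] := by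
        rw [← List.take_concat_get' _ _ hm, h1]
      have h3 : p.1[m + 1] ∉ p.1.take m ++ [p.1[m]] := by
        have h4 := (List.take_sublist (m + 1 + 1) p.1).nodup p.2
        rw [h2, List.nodup_append] at h4
        intro h5
        exact h4.2.2 _ h5 _ (by simp) rfl
      have h6 : pattern p m = decide (p.1[m + 1] < p.1[m]) := by
        rw [Bool.eq_iff_iff, pattern_eq_true hm, decide_eq_true_eq]
      rw [h2, labelSumAt_snoc y h3 hv hvk, lastLabelSum, h6]
      congr 1
      refine Finset.sum_congr rfl fun w hw => ?_
      rw [← h1]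
      refine ih (by omega) ?_
      rw [Finset.mem_range] at hw
      split_ifs at hw <;> omega

theorem labelSum_eq_partialSum (p : Permutation) (hp : 1 ≤ p.len) (k : ℕ) :
    labelSum y p.1 k = partialSum (lastLabelSum y (pattern p) (p.len - 1)) k := by
  rw [Permutation.len] at *
  have h1 : p.1.length - 1 < p.1.length := by omega
  rw [labelSum_eq_sum_labelSumAt y (List.getElem_mem h1), partialSum]
  refine Finset.sum_congr rfl fun v hv => ?_
  rw [← labelSumAt_take y p h1 (k := k) (by rw [Finset.mem_range] at hv; omega),
    Nat.sub_add_cancel hp, List.take_length]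

open PowerSeries in
theorem series_labelSum_perm (p : Permutation) (hp : 1 ≤ p.len) :
    (1 - X) * (1 - X ^ 2) ^ p.len * mk (labelSum y p.1) =
      leadFactor y p.len (udr p) (des p) *
        (if udr p % 2 = 1 then 1 + C y * X else C y + X) := by
  have h1 := series_labelSum y (pattern p) (p.len - 1)
  rwa [← udr_eq_numRuns hp, ← des_eq_numDes, Nat.sub_add_cancel hp,
    ← funext (labelSum_eq_partialSum y p hp)] at h1

end LastLabel

/-! ### The images of the classes -/

/-- Rational polynomials in `x` and `y`. -/
abbrev RatPoly : Type := MvPolynomial (Fin 2) ℚ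

/-- The coefficient of `t ^ k`, as an algebra homomorphism for the Hadamard product. -/
noncomputable def hadamardCoeff (k : ℕ) : HadamardPoly →ₐ[ℚ] RatPoly :=
  MvPolynomial.mapAlgHom (Pi.evalAlgHom ℚ (fun _ : ℕ => ℚ) k)

theorem coeff_hadamardCoeff (k : ℕ) (f : HadamardPoly) (m : Fin 2 →₀ ℕ) :
    MvPolynomial.coeff m (hadamardCoeff k f) = MvPolynomial.coeff m f k := by
  simp [hadamardCoeff, MvPolynomial.mapAlgHom_apply, MvPolynomial.coeff_map]

theorem hadamardCoeff_ext {f g : HadamardPoly} (h : ∀ k, hadamardCoeff k f = hadamardCoeff k g) :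
    f = g := by
  ext m k
  rw [← coeff_hadamardCoeff, ← coeff_hadamardCoeff, h]

/-- Polynomials over power series, regarded as power series over polynomials. -/
noncomputable def toSeries : OrdinaryPoly →+* PowerSeries RatPoly :=
  MvPolynomial.eval₂Hom (PowerSeries.map MvPolynomial.C) fun i => PowerSeries.C (MvPolynomial.X i)

theorem coeff_toSeries (k : ℕ) (f : OrdinaryPoly) (m : Fin 2 →₀ ℕ) :
    MvPolynomial.coeff m (PowerSeries.coeff k (toSeries f)) =
      PowerSeries.coeff k (MvPolynomial.coeff m f) := by
  induction f using MvPolynomial.induction_on' with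
  | monomial s a =>
    have h1 : toSeries (MvPolynomial.monomial s a) =
        PowerSeries.map MvPolynomial.C a * PowerSeries.C (MvPolynomial.monomial s 1) := by
      rw [toSeries, MvPolynomial.coe_eval₂Hom, MvPolynomial.eval₂_monomial]
      congr 1
      rw [MvPolynomial.monomial_eq, Finsupp.prod, Finsupp.prod, map_mul, map_prod]
      simp
    rw [h1, PowerSeries.coeff_mul_C, PowerSeries.coeff_map, MvPolynomial.coeff_C_mul,
      MvPolynomial.coeff_monomial, MvPolynomial.coeff_monomial]
    split_ifs <;> simp
  | add f g hf hg => simp only [map_add, MvPolynomial.coeff_add, hf, hg]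

theorem coeff_toHadamard (f : OrdinaryPoly) (m : Fin 2 →₀ ℕ) (k : ℕ) :
    MvPolynomial.coeff m (toHadamard f) k = PowerSeries.coeff k (MvPolynomial.coeff m f) := by
  classical
  rw [toHadamard, MvPolynomial.coeff_sum]
  simp only [MvPolynomial.coeff_monomial]
  rw [Finset.sum_ite_eq']
  split_ifs with h
  · rfl
  · rw [MvPolynomial.notMem_support_iff.1 h]; simp

/-- `toHadamard` does not respect products, while `toSeries` is a ring homomorphism. The explicit
expressions are therefore evaluated as ordinary series before their coefficients are compared. -/
theorem hadamardCoeff_toHadamard (k : ℕ) (f : OrdinaryPoly) :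
    hadamardCoeff k (toHadamard f) = PowerSeries.coeff k (toSeries f) := by
  ext m
  rw [coeff_hadamardCoeff, coeff_toHadamard, coeff_toSeries]

/-- The explicit expression with parameters `n`, `u`, `d`. -/
noncomputable def imageNumer (n u d : ℕ) : OrdinaryPoly :=
  t ^ u * (1 + y) ^ (u - 1) * (1 + y * t ^ 2) ^ (n - d - (u + 1) / 2)
    * (y + t ^ 2) ^ (d - u / 2) * S u

/-- Of the last two exponents one is `1` and the other `0`, according to the parity of `udr p`. -/
theorem numer_eq (p : Permutation) : numer p = imageNumer p.len (udr p) (des p) := by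
  rw [numer, imageNumer, mul_assoc _ (_ ^ _) (_ ^ _)]
  congr 1
  rw [S]
  split_ifs with h
  · rw [Nat.odd_iff] at h
    rw [show (udr p + 1) / 2 - udr p / 2 = 1 by omega,
      show 1 + udr p / 2 - (udr p + 1) / 2 = 0 by omega]
    simp
  · rw [Nat.odd_iff] at h
    rw [show (udr p + 1) / 2 - udr p / 2 = 0 by omega,
      show 1 + udr p / 2 - (udr p + 1) / 2 = 1 by omega]
    simp

theorem toSeries_t : toSeries t = PowerSeries.X := by simp [toSeries, t]

theorem toSeries_x : toSeries x = PowerSeries.C (MvPolynomial.X 0) := by simp [toSeries, x]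

theorem toSeries_y : toSeries y = PowerSeries.C (MvPolynomial.X 1) := by simp [toSeries, y]

theorem toSeries_invDenom (n : ℕ) :
    (1 - PowerSeries.X) * (1 - PowerSeries.X ^ 2) ^ n * toSeries (invDenom n) = 1 := by
  have h1 := PowerSeries.mul_inv_cancel
    ((1 - PowerSeries.X) * (1 - PowerSeries.X ^ 2) ^ n : PowerSeries ℚ) (by simp)
  have h2 := congrArg (PowerSeries.map (MvPolynomial.C (σ := Fin 2))) h1
  simpa [toSeries, invDenom] using h2

theorem toSeries_invOneSub : toSeries invOneSub = PowerSeries.mk 1 := by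
  have h1 := PowerSeries.mul_inv_cancel (1 - PowerSeries.X : PowerSeries ℚ) (by simp)
  have h2 := congrArg (PowerSeries.map (MvPolynomial.C (σ := Fin 2))) h1
  have h3 : (1 - PowerSeries.X) * toSeries invOneSub = 1 := by
    rw [map_mul, map_one, map_sub, map_one, PowerSeries.map_X] at h2
    rwa [toSeries, invOneSub, MvPolynomial.coe_eval₂Hom, MvPolynomial.eval₂_C]
  have h4 := PowerSeries.mk_one_mul_one_sub_eq_one RatPoly
  calc toSeries invOneSub
      = PowerSeries.mk 1 * (1 - PowerSeries.X) * toSeries invOneSub := by rw [h4, one_mul]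
    _ = PowerSeries.mk 1 := by rw [mul_assoc, h3, mul_one]

theorem toSeries_imageNumer (n u d : ℕ) : toSeries (imageNumer n u d) =
    leadFactor (MvPolynomial.X 1) n u d *
      (if u % 2 = 1 then 1 + PowerSeries.C (MvPolynomial.X 1) * PowerSeries.X
        else PowerSeries.C (MvPolynomial.X 1) + PowerSeries.X) := by
  rw [imageNumer, leadFactor, S]
  simp only [map_mul, map_pow, map_add, map_one, toSeries_t, toSeries_y, apply_ite toSeries,
    Nat.odd_iff]

/-- The coefficients of the image of a class are the generating polynomials of labelings. -/
theorem hadamardCoeff_image (p : Permutation) (k : ℕ) :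
    hadamardCoeff k (image p) =
      labelSum (MvPolynomial.X 1) p.1 k * MvPolynomial.X 0 ^ p.len := by
  rw [image]
  split_ifs with h
  · have h1 : p.1 = [] := List.length_eq_zero_iff.1 h
    rw [hadamardCoeff_toHadamard, toSeries_invOneSub, h, h1, labelSum_nil]
    simp
  · have h1 := series_labelSum_perm (MvPolynomial.X 1 : RatPoly) p (by omega)
    rw [← toSeries_imageNumer, ← numer_eq] at h1
    rw [hadamardCoeff_toHadamard, toSeries.map_mul, toSeries.map_mul, ← h1,
      mul_right_comm _ _ (toSeries (invDenom p.len)), toSeries_invDenom, one_mul, map_pow,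
      toSeries_x, ← map_pow, PowerSeries.coeff_mul_C,
      PowerSeries.coeff_mk]

/-- The Hadamard product acts on each power of `t` separately, so this is the product formula for
`labelSum` at every `k`, while the powers of `x` add up the lengths. -/
theorem image_mul_image {p q : Permutation} (h : DisjointPerm p q) :
    image p * image q = ∑ r ∈ shuffles p q, image r := by
  refine hadamardCoeff_ext fun k => ?_
  rw [map_mul, map_sum, hadamardCoeff_image, hadamardCoeff_image, mul_mul_mul_comm,
    labelSum_mul_labelSum _ h, ← pow_add, Finset.sum_mul]
  refine Finset.sum_congr rfl fun r hr => ?_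
  rw [hadamardCoeff_image, ((mem_shuffles h r).1 hr).1]

theorem image_nil : image ⟨[], List.nodup_nil⟩ = 1 := by
  refine hadamardCoeff_ext fun k => ?_
  rw [hadamardCoeff_image, labelSum_nil, map_one]
  simp [Permutation.len]

theorem image_congr {p q : Permutation} (h : udrDes.val p = udrDes.val q ∧ p.len = q.len) :
    image p = image q := by
  obtain ⟨h1, h2⟩ := h
  obtain ⟨h3, h4⟩ := Prod.mk.inj h1
  rw [image, image, numer_eq, numer_eq, h2, h3, h4]

/-! ### Linear independence of the images -/

/-- The lowest power of `y` in the lowest coefficient of the image of a class. -/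
def lowExponent (u d : ℕ) : ℕ := d - u / 2 + if u % 2 = 1 ∨ u = 0 then 0 else 1

/-- Set `t = 0` in the cofactor of `t ^ u`: `1 + y t ^ 2` and the denominator become `1`, `y + t ^
2` becomes `y`, and the last factor becomes `1` for odd `u` and `y` for even `u`. The case `u = 0`
is the empty permutation, with coefficient `1`. -/
theorem hadamardCoeff_image_low (p : Permutation) :
    (∀ k < udr p, hadamardCoeff k (image p) = 0) ∧
      hadamardCoeff (udr p) (image p) =
        (1 + MvPolynomial.X 1) ^ (udr p - 1) * MvPolynomial.X 1 ^ lowExponent (udr p) (des p) *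
          MvPolynomial.X 0 ^ p.len := by
  rcases Nat.eq_zero_or_pos p.len with hp | hp
  · have h1 : p.1 = [] := List.length_eq_zero_iff.1 hp
    simp [udr_of_length_zero hp, des_of_length_zero hp, lowExponent, hadamardCoeff_image, h1,
      labelSum_nil, Permutation.len]
  obtain ⟨G, hG⟩ : ∃ G : PowerSeries RatPoly, G = (1 + PowerSeries.C (MvPolynomial.X 1)) ^ (udr p - 1)
    * (1 + PowerSeries.C (MvPolynomial.X 1) * PowerSeries.X ^ 2) ^
      (p.len - des p - (udr p + 1) / 2)
    * (PowerSeries.C (MvPolynomial.X 1) + PowerSeries.X ^ 2) ^ (des p - udr p / 2)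
    * (if udr p % 2 = 1 then 1 + PowerSeries.C (MvPolynomial.X 1) * PowerSeries.X
        else PowerSeries.C (MvPolynomial.X 1) + PowerSeries.X)
    * toSeries (invDenom p.len) * PowerSeries.C (MvPolynomial.X 0) ^ p.len := ⟨_, rfl⟩
  have h1 : ∀ k, hadamardCoeff k (image p) =
      PowerSeries.coeff k (PowerSeries.X ^ udr p * G) := by
    intro k
    rw [image, if_neg (by omega), hadamardCoeff_toHadamard, toSeries.map_mul, toSeries.map_mul,
      numer_eq, toSeries_imageNumer, map_pow, toSeries_x, leadFactor, hG]
    simp only [mul_assoc]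
  have h2 : PowerSeries.constantCoeff (toSeries (invDenom p.len)) = 1 := by
    have h3 := congrArg PowerSeries.constantCoeff (toSeries_invDenom p.len)
    simpa using h3
  constructor
  · intro k hk
    rw [h1, PowerSeries.coeff_X_pow_mul', if_neg (by omega)]
  · rw [h1, PowerSeries.coeff_X_pow_mul', if_pos le_rfl, Nat.sub_self,
      PowerSeries.coeff_zero_eq_constantCoeff_apply, hG]
    simp only [map_mul, map_pow, map_add, map_one, h2, apply_ite PowerSeries.constantCoeff,
      PowerSeries.constantCoeff_C, PowerSeries.constantCoeff_X, lowExponent]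
    have h3 : udr p ≠ 0 := by have := admissible_udr_des p; unfold Admissible at this; omega
    simp only [h3, or_false]
    split_ifs <;> simp [pow_add, mul_assoc]

/-- Polynomials in `x` and `y` as iterated polynomials. -/
noncomputable def toIterated : RatPoly →ₐ[ℚ] Polynomial (Polynomial ℚ) :=
  MvPolynomial.aeval ![Polynomial.X, Polynomial.C Polynomial.X]

/-- The functional that extracts the lowest coefficient of the image of a class. -/
noncomputable def lowCoeff (n u d : ℕ) : HadamardPoly →ₗ[ℚ] ℚ :=
  Polynomial.lcoeff ℚ (lowExponent u d) ∘ₗ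
    (Polynomial.lcoeff (Polynomial ℚ) n).restrictScalars ℚ ∘ₗ
      toIterated.toLinearMap ∘ₗ (hadamardCoeff u).toLinearMap

theorem lowCoeff_apply (n u d : ℕ) (f : HadamardPoly) :
    lowCoeff n u d f = ((toIterated (hadamardCoeff u f)).coeff n).coeff (lowExponent u d) := rfl

theorem lowCoeff_image_of_lt (p : Permutation) (n u d : ℕ) (h : u < udr p) :
    lowCoeff n u d (image p) = 0 := by
  rw [lowCoeff_apply, (hadamardCoeff_image_low p).1 u h]
  simp

theorem lowCoeff_image (p : Permutation) (n d : ℕ) :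
    lowCoeff n (udr p) d (image p) = if n = p.len then
      ((1 + Polynomial.X) ^ (udr p - 1) * Polynomial.X ^ lowExponent (udr p) (des p) :
        Polynomial ℚ).coeff (lowExponent (udr p) d) else 0 := by
  have h1 : toIterated ((1 + MvPolynomial.X 1) ^ (udr p - 1) *
      MvPolynomial.X 1 ^ lowExponent (udr p) (des p) * MvPolynomial.X 0 ^ p.len) =
      Polynomial.C ((1 + Polynomial.X) ^ (udr p - 1) *
        Polynomial.X ^ lowExponent (udr p) (des p)) * Polynomial.X ^ p.len := by
    simp [toIterated]
  rw [lowCoeff_apply, (hadamardCoeff_image_low p).2, h1, Polynomial.coeff_C_mul_X_pow]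
  split_ifs <;> simp

theorem lowCoeff_image_self (p : Permutation) :
    lowCoeff p.len (udr p) (des p) (image p) = 1 := by
  rw [lowCoeff_image, if_pos rfl, Polynomial.coeff_mul_X_pow', if_pos le_rfl,
    Nat.sub_self, Polynomial.coeff_zero_eq_eval_zero]
  simp

/-- Triangularity. A larger `udr` pushes the lowest power of `t` up; for equal `udr`, different
lengths are separated by the power of `x`, and a larger `des` pushes the lowest power of `y` up. -/
theorem lowCoeff_image_of_ne {p q : Permutation} (h : mkClass udrDes p ≠ mkClass udrDes q)
    (hle : udr p < udr q ∨ (udr p = udr q ∧ des p ≤ des q)) :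
    lowCoeff p.len (udr p) (des p) (image q) = 0 := by
  rcases hle with hle | ⟨h1, h2⟩
  · exact lowCoeff_image_of_lt q _ _ _ hle
  · rw [h1, lowCoeff_image]
    split_ifs with h3
    · have h4 : des p ≠ des q := fun h4 => h (mkClass_eq.2 ⟨Prod.ext h1 h4, h3⟩)
      have h5 := admissible_udr_des p
      have h6 := admissible_udr_des q
      unfold Admissible at h5 h6
      rw [Polynomial.coeff_mul_X_pow', if_neg]
      unfold lowExponent
      omega
    · rfl

/-- The image of a class. -/
noncomputable def classImage : StatClass udrDes → HadamardPoly :=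
  Quotient.lift image fun _ _ => image_congr

theorem classImage_mkClass (p : Permutation) : classImage (mkClass udrDes p) = image p := rfl

theorem linearIndependent_classImage : LinearIndependent ℚ classImage := by
  classical
  rw [linearIndependent_iff]
  intro l hl
  by_contra hne
  -- The functional of a lexicographically minimal class in the support annihilates all other images
  -- there, so it isolates a nonzero coefficient. The order ignores lengths, hence ties are
  -- possible; they are harmless by the power of `x`.
  obtain ⟨c, hc, hmin⟩ := l.support.exists_min_image
    (fun c => toLex (udr c.out, des c.out)) (Finsupp.support_nonempty_iff.2 hne)
  have hout : ∀ c : StatClass udrDes, mkClass udrDes c.out = c := fun c => Quotient.out_eq c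
  have h1 := congrArg (lowCoeff (Permutation.len c.out) (udr c.out) (des c.out)) hl
  rw [Finsupp.linearCombination_apply, Finsupp.sum, map_sum, map_zero,
    Finset.sum_eq_single_of_mem c hc, map_smul, ← hout c, classImage_mkClass, hout c,
    lowCoeff_image_self, smul_eq_mul, mul_one] at h1
  · exact Finsupp.mem_support_iff.1 hc h1
  · intro c' hc' hcc'
    have h2 := hmin c' hc'
    rw [Prod.Lex.toLex_le_toLex] at h2
    rw [map_smul, ← hout c', classImage_mkClass, lowCoeff_image_of_ne _ h2, smul_zero]
    rw [hout, hout]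
    exact hcc'.symm

/-! ### The main theorem -/

/-- The product of two images depends only on the classes of the factors, and independence recovers
from it the multiset of classes of the shuffles. -/
theorem shuffleCompatible_udrDes : ShuffleCompatible udrDes := by
  classical
  intro p p' q q' hpq hpq' hp hq hvp hvq
  have key : ∀ p q : Permutation, ∑ r ∈ shuffles p q, image r =
      Finsupp.linearCombination ℚ classImage
        (∑ r ∈ shuffles p q, Finsupp.single (mkClass udrDes r) 1) := by
    intro p q
    rw [map_sum]
    exact Finset.sum_congr rfl fun r _ => by
      rw [Finsupp.linearCombination_single, one_smul, classImage_mkClass]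
  have h1 : ∑ r ∈ shuffles p q, image r = ∑ r ∈ shuffles p' q', image r := by
    rw [← image_mul_image hpq, ← image_mul_image hpq', image_congr ⟨hvp, hp⟩,
      image_congr ⟨hvq, hq⟩]
  rw [key, key] at h1
  have h2 := linearIndependent_classImage h1
  have h3 : (shuffles p q).val.map (mkClass udrDes) =
      (shuffles p' q').val.map (mkClass udrDes) := by
    have h4 : ∀ (p q : Permutation) (c : StatClass udrDes),
        (∑ r ∈ shuffles p q, Finsupp.single (mkClass udrDes r) (1 : ℚ)) c =
          (((shuffles p q).val.map (mkClass udrDes)).count c : ℚ) := by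
      intro p q c
      rw [Finsupp.finsetSum_apply, Multiset.count_map]
      simp only [Finsupp.single_apply]
      rw [Finset.sum_boole]
      simp [Finset.card, eq_comm]
    ext c
    have h5 := DFunLike.congr_fun h2 c
    rw [h4, h4] at h5
    exact_mod_cast h5
  -- Equality was obtained for classes, which also record the length; `g` forgets it.
  let g : StatClass udrDes → ℕ × ℕ :=
    Quotient.lift (s := statSetoid udrDes) udrDes.val fun _ _ h => And.left h
  have h6 := congrArg (Multiset.map g) h3
  rw [Multiset.map_map, Multiset.map_map] at h6
  exact h6

/-- The three families correspond to the three cases of `Admissible`: the empty permutation, `udr =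
1`, and `udr ≥ 2`. -/
theorem range_image : Set.range image = spanningSet := by
  ext f
  constructor
  · rintro ⟨p, rfl⟩
    rw [image, numer_eq]
    rcases admissible_udr_des p with ⟨h, -, -⟩ | ⟨h, hu, hd⟩ | ⟨h1, h2, h3, h4⟩
    · exact Or.inl (Or.inl (if_pos h))
    · refine Or.inl (Or.inr ⟨p.len, h, ?_⟩)
      rw [if_neg (by omega), hu, hd, imageNumer]
      simp [S]
      ring_nf
    · exact Or.inr ⟨p.len, udr p, des p, by omega, h1, h2, h3, h4, if_neg (by omega)⟩
  · rintro ((rfl | ⟨n, hn, rfl⟩) | ⟨n, j, k, hn, h1, h2, h3, h4, rfl⟩)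
    · exact ⟨⟨[], List.nodup_nil⟩, if_pos rfl⟩
    · obtain ⟨p, hp, hu, hd⟩ := exists_perm_of_admissible (n := n) (u := 1) (d := 0)
        (Or.inr (Or.inl ⟨hn, rfl, rfl⟩))
      refine ⟨p, ?_⟩
      rw [image, if_neg (by omega), numer_eq, hp, hu, hd, imageNumer]
      simp [S]
      ring_nf
    · obtain ⟨p, hp, hu, hd⟩ := exists_perm_of_admissible (n := n) (u := j) (d := k)
        (Or.inr (Or.inr ⟨h1, h2, h3, h4⟩))
      refine ⟨p, ?_⟩
      rw [image, if_neg (by omega), numer_eq, hp, hu, hd, imageNumer]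

/-! ### The algebra isomorphism onto the span -/

/-- The linear map that sends each class to its image. -/
noncomputable def imageLinearMap (h : ShuffleCompatible udrDes) :
    ShuffleAlgebra udrDes h →ₗ[ℚ] HadamardPoly :=
  (classBasis udrDes h).constr ℚ classImage

theorem imageLinearMap_cls (h : ShuffleCompatible udrDes) (p : Permutation) :
    imageLinearMap h (cls udrDes h p) = image p := by
  rw [imageLinearMap, cls, Module.Basis.constr_basis, classImage_mkClass]

theorem imageLinearMap_mul (h : ShuffleCompatible udrDes) (a b : ShuffleAlgebra udrDes h) :
    imageLinearMap h (a * b) = imageLinearMap h a * imageLinearMap h b := by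
  have key : (mulBilin udrDes h).compr₂ (imageLinearMap h) =
      (LinearMap.mul ℚ HadamardPoly).compl₁₂ (imageLinearMap h) (imageLinearMap h) := by
    refine (classBasis udrDes h).ext fun a => (classBasis udrDes h).ext fun b => ?_
    obtain ⟨p, rfl, -⟩ := exists_rep_avoiding udrDes a []
    obtain ⟨q, rfl, hq⟩ := exists_rep_avoiding udrDes b p.1
    have h1 : DisjointPerm p q := fun x hx hx' => hq x hx' hx
    change imageLinearMap h (cls udrDes h p * cls udrDes h q) =
      imageLinearMap h (cls udrDes h p) * imageLinearMap h (cls udrDes h q)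
    rw [cls_mul_cls h1, map_sum, imageLinearMap_cls, imageLinearMap_cls, image_mul_image h1]
    exact Finset.sum_congr rfl fun r _ => imageLinearMap_cls h r
  exact LinearMap.congr_fun₂ key a b

/-- The algebra homomorphism that sends each class to its image. -/
noncomputable def imageAlgHom (h : ShuffleCompatible udrDes) :
    ShuffleAlgebra udrDes h →ₐ[ℚ] HadamardPoly :=
  AlgHom.ofLinearMap (imageLinearMap h) ((imageLinearMap_cls h _).trans image_nil)
    (imageLinearMap_mul h)

theorem imageAlgHom_injective (h : ShuffleCompatible udrDes) :
    Function.Injective (imageAlgHom h) := by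
  intro a b hab
  have h1 : imageLinearMap h a = imageLinearMap h b := hab
  rw [imageLinearMap, Module.Basis.constr_apply, Module.Basis.constr_apply] at h1
  exact (classBasis udrDes h).repr.injective (linearIndependent_classImage h1)

theorem range_imageAlgHom (h : ShuffleCompatible udrDes) :
    Subalgebra.toSubmodule (imageAlgHom h).range = Submodule.span ℚ spanningSet := by
  have h1 : Subalgebra.toSubmodule (imageAlgHom h).range = LinearMap.range (imageLinearMap h) := by
    ext f
    rfl
  have h2 : Set.range classImage = Set.range image := by
    ext f
    constructor
    · rintro ⟨c, rfl⟩
      obtain ⟨p, rfl⟩ := Quotient.exists_rep c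
      exact ⟨p, rfl⟩
    · rintro ⟨p, rfl⟩
      exact ⟨mkClass udrDes p, rfl⟩
  rw [h1, imageLinearMap, Module.Basis.constr_range, h2, range_image]

/-! ### Dimensions of the homogeneous components -/

/-- The possible values of `(udr, des)` on the permutations of length `n`, as a finite set. -/
def admissiblePairs (n : ℕ) : Finset (ℕ × ℕ) :=
  if n = 0 then {(0, 0)} else
    insert (1, 0) ((Finset.Icc 2 n).biUnion fun u =>
      (Finset.Icc (u / 2) (n - (u + 1) / 2)).image fun d => (u, d))

theorem mem_admissiblePairs {n : ℕ} {z : ℕ × ℕ} :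
    z ∈ admissiblePairs n ↔ Admissible n z.1 z.2 := by
  obtain ⟨u, d⟩ := z
  unfold admissiblePairs Admissible
  split_ifs with h
  · simp only [Finset.mem_singleton, Prod.mk.injEq]
    omega
  · simp only [Finset.mem_insert, Finset.mem_biUnion, Finset.mem_image, Finset.mem_Icc,
      Prod.mk.injEq]
    constructor
    · rintro (h1 | ⟨u', h1, d', h2, rfl, rfl⟩) <;> omega
    · rintro (h1 | h1 | h1)
      · omega
      · exact Or.inl h1.2
      · exact Or.inr ⟨u, by omega, d, by omega, rfl, rfl⟩

theorem card_admissiblePairs (n : ℕ) : (admissiblePairs n).card = n.choose 2 + 1 := by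
  unfold admissiblePairs
  split_ifs with h
  · simp [h]
  · rw [Finset.card_insert_of_notMem, Finset.card_biUnion]
    -- The two halves of `u` add up to `u`, so each `u` admits `n + 1 - u` values of `d`. These sum
    -- to `1 + ... + (n - 1)`, and the pair `(1, 0)` adds one.
    · have h1 : ∀ u ∈ Finset.Icc 2 n, ((Finset.Icc (u / 2) (n - (u + 1) / 2)).image
          fun d => (u, d)).card = n + 1 - u := by
        intro u hu
        rw [Finset.mem_Icc] at hu
        rw [Finset.card_image_of_injective _ (Prod.mk_right_injective u), Nat.card_Icc]
        omega
      rw [Finset.sum_congr rfl h1]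
      congr 1
      clear h h1
      induction n with
      | zero => rfl
      | succ n ih =>
        rcases Nat.eq_zero_or_pos n with rfl | hn
        · rfl
        · rw [Finset.sum_Icc_succ_top (by omega), Nat.choose_succ_succ' n 1,
            Nat.choose_one_right]
          have h2 : ∀ u ∈ Finset.Icc 2 n, n + 1 + 1 - u = (n + 1 - u) + 1 := by
            intro u hu
            rw [Finset.mem_Icc] at hu
            omega
          rw [Finset.sum_congr rfl h2, Finset.sum_add_distrib, ih, Finset.sum_const,
            Nat.card_Icc, smul_eq_mul]
          norm_num only
          omega
    · intro u _ v _ huv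
      rw [Function.onFun, Finset.disjoint_left]
      simp only [Finset.mem_image, not_exists, not_and]
      rintro z ⟨d, _, rfl⟩ d' _ h3
      exact huv (Prod.mk.inj h3).1.symm
    · simp

theorem finrank_homogeneousComponent (h : ShuffleCompatible udrDes) (n : ℕ) :
    Module.finrank ℚ (homogeneousComponent udrDes h n) = n.choose 2 + 1 := by
  choose p hlen hu hd using fun z : admissiblePairs n =>
    exists_perm_of_admissible (mem_admissiblePairs.1 z.2)
  have hinj : Function.Injective fun z => mkClass udrDes (p z) := by
    intro z z' hz
    have h1 := Prod.mk.inj (mkClass_eq.1 hz).1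
    rw [hu, hu, hd, hd] at h1
    exact Subtype.ext (Prod.ext h1.1 h1.2)
  have hli : LinearIndependent ℚ fun z => cls udrDes h (p z) :=
    (classBasis udrDes h).linearIndependent.comp _ hinj
  have hrange : {a | ∃ q : Permutation, q.len = n ∧ a = cls udrDes h q} =
      Set.range fun z => cls udrDes h (p z) := by
    ext a
    constructor
    · rintro ⟨q, hq, rfl⟩
      refine ⟨⟨(udr q, des q), mem_admissiblePairs.2 (hq ▸ admissible_udr_des q)⟩, ?_⟩
      simp only [cls]
      congr 1
      exact mkClass_eq.2 ⟨Prod.ext (hu _) (hd _), (hlen _).trans hq.symm⟩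
    · rintro ⟨z, rfl⟩
      exact ⟨p z, hlen z, rfl⟩
  rw [homogeneousComponent, hrange, finrank_span_eq_card hli, Fintype.card_coe,
    card_admissiblePairs]

end ShuffleCompat

/-- The pair `(udr, des)` is shuffle-compatible; the map sending the class of a permutation `p` to
`image p` is an isomorphism of `ℚ`-algebras from its shuffle algebra onto the span of the explicit
spanning set, which is a subalgebra of the Hadamard algebra; and the `n`th homogeneous component
has dimension `n.choose 2 + 1`. -/
theorem theorem5p11 :
    ∃ h : ShuffleCompat.ShuffleCompatible ShuffleCompat.udrDes,
      (∃ (B : Subalgebra ℚ ShuffleCompat.HadamardPoly)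
          (e : ShuffleCompat.ShuffleAlgebra ShuffleCompat.udrDes h ≃ₐ[ℚ] B),
        Subalgebra.toSubmodule B = Submodule.span ℚ ShuffleCompat.spanningSet ∧
        ∀ p : ShuffleCompat.Permutation,
          (e (ShuffleCompat.cls ShuffleCompat.udrDes h p) : ShuffleCompat.HadamardPoly) =
            ShuffleCompat.image p) ∧
      ∀ n : ℕ,
        Module.finrank ℚ
          (ShuffleCompat.homogeneousComponent ShuffleCompat.udrDes h n) = n.choose 2 + 1 := by
  refine ⟨ShuffleCompat.shuffleCompatible_udrDes,
    ⟨(ShuffleCompat.imageAlgHom _).range, AlgEquiv.ofInjective _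
      (ShuffleCompat.imageAlgHom_injective ShuffleCompat.shuffleCompatible_udrDes),
      ShuffleCompat.range_imageAlgHom _, fun p => ?_⟩,
    ShuffleCompat.finrank_homogeneousComponent _⟩
  exact ShuffleCompat.imageLinearMap_cls _ p
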